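/- Let $\mathbb T^n=\mathbb R^n/\mathbb Z^n$, let $|x|=\sum_i|x_i|$ for vectors $x$, and let $D=\{I\in\mathbb R^n : |I|<1\}$. Let $M=(M_l)_{l\in\mathbb N}$ be a sequence of positive real numbers with $M_0=M_1=1$, and put $\mu_l=M_{l+1}/M_l$, $N_l=M_l/l!$, $\nu_l=N_{l+1}/N_l$ and $\Omega(y)=\ln\big(\sup_{l\in\mathbb N}y^lM_l^{-1}\big)$ for $y\ge 0$. Assume (H1) the sequence $\nu$ is non-decreasing; (H2) $\lim_{l\to\infty}l^{-1}\ln\mu_l=0$; (H3) $\sum_{l\in\mathbb N}M_l/M_{l+1}<+\infty$ (non-quasi-analyticity). For $s>0$ and a smooth function $H$ on $\mathbb T^n\times D$ put $$|H|_{s}=\frac{4\pi^2}{3}\,\sup_{(\theta,I)\in\mathbb T^n\times D}\ \sup_{k\in\mathbb N^{2n}}\frac{(|k|+1)^2s^{|k|}\,|\partial^kH(\theta,I)|}{M_{|k|}},\qquad |k|=k_1+\dots+k_{2n},$$ and call $H$ $(M,s)$-ultra-differentiable if $|H|_s<\infty$. **Theorem (Arnold diffusion in non-quasi-analytic classes).**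 Let $n\ge 3$, let $M$ be as above and satisfy (H1), (H2) and (H3), and let $s>0$. Then there are constants $0<c_1<c_2<1$, depending only on $n$, $s$ and $M$, such that the following holds. There exist a function $h:D\to\mathbb R$, constants $l,m>0$, functions $f_j:\mathbb T^n\times D\to\mathbb R$ and real numbers $\varepsilon_j>0$ $(j\in\mathbb N)$ such that: 1. $h$ is $(l,m)$-quasi-convex on $D$: for every $I\in D$ one has $|\nabla h(I)|\ge l$, and for every $\xi\in\mathbb R^n$ at least one of the inequalities $|\nabla h(I)\cdot\xi|\ge l|\xi|$ and $|\nabla^2h(I)\xi\cdot\xi|\ge m|\xi|^2$ holds; 2. for every $j$, the functions $f_j$ and $H_j(\theta,I)=h(I)+f_j(\theta,I)$ are $(M,s)$-ultra-differentiable, $|f_j|_s\le\varepsilon_j$, and $\lim_{j\to\infty}\varepsilon_j=0$; 3. for every $j$ there are $\tau_j>0$ and a solution $(\theta_j(t),I_j(t))\in\mathbb T^n\times D$, $0\le t\le\tau_j$, of Hamilton's equations $\dot\theta=\partial_IH_j(\theta,I)$, $\dot I=-\partial_\theta H_j(\theta,I)$, with $$|I_j(\tau_j)-I_j(0)|\ge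 1;$$ 4. for all $j$ large enough, $$\exp\Big(2\Omega\big(c_1\varepsilon_j^{-\frac1{2(n-2)}}\big)\Big)\le\tau_j\le\exp\Big(2\Omega\big(c_2\varepsilon_j^{-\frac1{2(n-2)}}\big)\Big).$$ -/

import Mathlib

open Filter Topology
open scoped ENNReal ContDiff

namespace UltraDiffusion

noncomputable section

/-! ### Weight sequences -/

/-- `μ_l = M_{l+1} / M_l`. -/
def muSeq (M : ℕ → ℝ) (l : ℕ) : ℝ := M (l + 1) / M l

/-- `N_l = M_l / l!`. -/
def NSeq (M : ℕ → ℝ) (l : ℕ) : ℝ := M l / (l.factorial : ℝ)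

/-- `ν_l = N_{l+1} / N_l`. -/
def nuSeq (M : ℕ → ℝ) (l : ℕ) : ℝ := NSeq M (l + 1) / NSeq M l

/-- A sequence of positive reals normalised by `M_0 = M_1 = 1`. -/
def IsWeight (M : ℕ → ℝ) : Prop := (∀ l, 0 < M l) ∧ M 0 = 1 ∧ M 1 = 1

/-- (H1): the sequence `N` is log-convex, i.e. `ν` is non-decreasing. -/
def CondH1 (M : ℕ → ℝ) : Prop := Monotone (nuSeq M)

/-- (H2): the sequence `μ` is sub-exponential, i.e. `l⁻¹ ln μ_l → 0`. -/
def CondH2 (M : ℕ → ℝ) : Prop :=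
  Tendsto (fun l : ℕ => (l : ℝ)⁻¹ * Real.log (muSeq M l)) atTop (𝓝 0)

/-- (H3), non-quasi-analyticity: `∑ M_l / M_{l+1} < ∞`. -/
def CondH3 (M : ℕ → ℝ) : Prop := Summable (fun l : ℕ => M l / M (l + 1))

/-- `Ω(y) = ln (sup_l y^l / M_l)`.  (For a weight satisfying (H1) one has `M_l ≥ l!`, so that the
supremum is finite for every `y ≥ 0`.) -/
def Omega (M : ℕ → ℝ) (y : ℝ) : ℝ := Real.log (⨆ l : ℕ, y ^ l / M l)

/-! ### The phase space `𝕋ⁿ × D` -/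

/-- The torus `𝕋ⁿ = ℝⁿ / ℤⁿ`. -/
abbrev Torus (n : ℕ) : Type := Fin n → UnitAddCircle

/-- The projection `ℝⁿ → 𝕋ⁿ`. -/
def toTorus {n : ℕ} (x : Fin n → ℝ) : Torus n := fun i => (x i : UnitAddCircle)

/-- The `ℓ¹`-norm, which is the norm used for all vectors of `ℝⁿ`. -/
def norm1 {n : ℕ} (x : Fin n → ℝ) : ℝ := ∑ i, |x i|

/-- The open ball `D` of radius one centred at the origin of `ℝⁿ`. -/
def ballD (n : ℕ) : Set (Fin n → ℝ) := {I | norm1 I < 1}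

/-- The lift to `ℝⁿ × ℝⁿ` of a function of `(θ, I) ∈ 𝕋ⁿ × ℝⁿ`, i.e. the function read in the
standard local coordinates; only the values for `I ∈ D` are ever used. -/
def lift {n : ℕ} (H : Torus n → (Fin n → ℝ) → ℝ) : (Fin n → ℝ) × (Fin n → ℝ) → ℝ :=
  fun p => H (toTorus p.1) p.2

/-- The coordinate vector `∂/∂θ_i`. -/
def dirTheta {n : ℕ} (i : Fin n) : (Fin n → ℝ) × (Fin n → ℝ) := (Pi.single i 1, 0)

/-- The coordinate vector `∂/∂I_i`. -/
def dirAction {n : ℕ} (i : Fin n) : (Fin n → ℝ) × (Fin n → ℝ) := (0, Pi.single i 1)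

/-- The `2n` coordinate vectors: first those of the angles, then those of the actions. -/
def dir {n : ℕ} : Fin (n + n) → (Fin n → ℝ) × (Fin n → ℝ) :=
  Fin.append dirTheta dirAction

/-- The partial derivative `∂^k F(p) = ∂_1^{k_1} ⋯ ∂_{2n}^{k_{2n}} F(p)` for a multi-index
`k ∈ ℕ^{2n}`: the derivative of order `|k|` evaluated on `k_1` copies of the first coordinate
vector, followed by `k_2` copies of the second one, and so on. -/
def partialDeriv {n : ℕ} (k : Fin (n + n) → ℕ) (F : (Fin n → ℝ) × (Fin n → ℝ) → ℝ)
    (p : (Fin n → ℝ) × (Fin n → ℝ)) : ℝ :=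
  iteratedFDeriv ℝ (∑ i, k i) F p (fun a => dir (finSigmaFinEquiv.symm a).1)

/-- `|H|_{M,s} = c sup_{(θ,I) ∈ 𝕋ⁿ × D} sup_{k ∈ ℕ^{2n}}
(|k|+1)² s^{|k|} |∂^k H(θ,I)| / M_{|k|}` with `c = 4π²/3`, as an element of `[0, ∞]`. -/
def ultraNorm {n : ℕ} (M : ℕ → ℝ) (s : ℝ) (H : Torus n → (Fin n → ℝ) → ℝ) : ℝ≥0∞ :=
  ENNReal.ofReal (4 * Real.pi ^ 2 / 3) *
    ⨆ (x : Fin n → ℝ) (I ∈ ballD n) (k : Fin (n + n) → ℕ),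
      ENNReal.ofReal ((((∑ i, k i : ℕ) : ℝ) + 1) ^ 2 * s ^ (∑ i, k i) *
        |partialDeriv k (lift H) (x, I)| / M (∑ i, k i))

/-- `H` is `(M,s)`-ultra-differentiable on `𝕋ⁿ × D`: it is smooth there and `|H|_{M,s} < ∞`. -/
def IsUltraDiff {n : ℕ} (M : ℕ → ℝ) (s : ℝ) (H : Torus n → (Fin n → ℝ) → ℝ) : Prop :=
  ContDiffOn ℝ ∞ (lift H) (Set.univ ×ˢ ballD n) ∧ ultraNorm M s H < ⊤

/-! ### Quasi-convexity -/

/-- The gradient `∇h(I)`. -/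
def grad {n : ℕ} (h : (Fin n → ℝ) → ℝ) (I : Fin n → ℝ) : Fin n → ℝ :=
  fun i => fderiv ℝ h I (Pi.single i 1)

/-- `h` is `(l,m)`-quasi-convex on `G`: for all `I ∈ G`, `|∇h(I)| ≥ l`, and for every `ξ` at least
one of `|∇h(I)·ξ| ≥ l|ξ|` and `|∇²h(I)ξ·ξ| ≥ m|ξ|²` holds. -/
def IsQuasiConvex {n : ℕ} (l m : ℝ) (h : (Fin n → ℝ) → ℝ) (G : Set (Fin n → ℝ)) : Prop :=
  ∀ I ∈ G, l ≤ norm1 (grad h I) ∧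
    ∀ ξ : Fin n → ℝ, l * norm1 ξ ≤ |∑ i, grad h I i * ξ i| ∨
      m * norm1 ξ ^ 2 ≤ |iteratedFDeriv ℝ 2 h I ![ξ, ξ]|

/-! ### Hamilton's equations -/

/-- `(θ(t), I(t))`, `t ∈ [0, T]`, is a solution in `𝕋ⁿ × D` of the Hamiltonian system of `H`,
`θ' = ∂_I H(θ, I)`, `I' = -∂_θ H(θ, I)`; the curve `θ` is written as the projection of a curve `x`
in `ℝⁿ`. -/
def IsSolution {n : ℕ} (H : Torus n → (Fin n → ℝ) → ℝ) (T : ℝ)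
    (θ : ℝ → Torus n) (I : ℝ → Fin n → ℝ) : Prop :=
  ∃ x : ℝ → Fin n → ℝ, ∀ t ∈ Set.Icc 0 T,
    θ t = toTorus (x t) ∧ I t ∈ ballD n ∧
    ∀ i, HasDerivWithinAt (fun u => x u i)
          (fderiv ℝ (lift H) (x t, I t) (dirAction i)) (Set.Icc 0 T) t ∧
      HasDerivWithinAt (fun u => I u i)
          (-fderiv ℝ (lift H) (x t, I t) (dirTheta i)) (Set.Icc 0 T) t

end

end UltraDiffusion

open UltraDiffusion

namespace UltraDiffusion

/-! The drifting orbit is written down explicitly. Put `N = p^(n-2)` and `q = N m`, with `m` a large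
integer. The integrable part is `I_0² + (A/2)(I_1² + ⋯ + I_{n-2}²) + I_{n-1}`, so the last angle is
time. The perturbation depends on the angles only and has two terms.

The first term, of size about `N⁻²`, makes the angle of index `n-2` a pendulum. It rotates with
velocity `1/N` away from the top of its potential, and, being close to the separatrix, takes a total
time `q` per turn, where `m` is arbitrary. The other middle angles rotate uniformly with frequencies
`1/p, …, 1/p^(n-3)`. The size `ε ~ p^(-2(n-2))` of this term is the origin of the exponent
`1/(2(n-2))`.

The second term is a kick `-δ w(θ_0) (b β ∏ D_p)²`. Once per unit of time the last angle passes
through the support of `β`. The bump `b` in the pendulum angle and the kernels `D_p`, trigonometric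
polynomials of degree less than `p`, annihilate the kick and its differential on the orbit at all
these passages except those at multiples of `q`. There the kernels and `b` are critical, so only
`I_0` and `I_{n-1}` are affected. Each kick increases `I_0` by `1/q`; after `q` periods, in time `τ
= q²`, the drift is `1`. At the times `kq` the angle `θ_0` is an integer, so every kick meets `w`
where it is the identity modulo 1 (`kickTrain_mul_deriv_ramp`, `exists_drifting_orbit`).

The price is paid in the norm: in the class `M` the product of kernels has size at most `S(Cp)`
(`DerivBound.of_one`), and `δ` is of order `1/(N m)`, so `|f| ≤ ε` as soon as `m ≥ K N S(Cp)`
(`exists_drifting_family`). By (H2) a dilation of the argument of `S` absorbs powers of `p`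
(`IsWeight.eventually_mul_weightSup_le`), so `m = ⌈S(2Cp)⌉` is admissible and `q` lies between
`S(2Cp)` and `S(4Cp)`. Since `p` is proportional to `ε^(-1/(2(n-2)))`, this is the two-sided
estimate of `τ`.

(H3) provides the bumps: a Lipschitz profile is averaged over infinitely many windows of lengths
proportional to `M_i / M_{i+1}` (`exists_mollification`, `IsWeight.exists_windows`). (H1) makes the
class stable under products. -/

/-- The generating function `S(y) = sup_l y^l / M_l`, so that `Ω = ln S`. -/
noncomputable def weightSup (M : ℕ → ℝ) (y : ℝ) : ℝ := ⨆ l : ℕ, y ^ l / M l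

/-! ### Weight sequences and the growth of `S`. -/

section Weight

variable {M : ℕ → ℝ}

lemma IsWeight.muSeq_pos (hM : IsWeight M) (l : ℕ) : 0 < muSeq M l :=
  div_pos (hM.1 _) (hM.1 _)

lemma IsWeight.mul_muSeq (hM : IsWeight M) (l : ℕ) : M l * muSeq M l = M (l + 1) := by
  have := (hM.1 l).ne'
  unfold muSeq; field_simp

lemma IsWeight.muSeq_eq (hM : IsWeight M) (l : ℕ) : muSeq M l = (l + 1) * nuSeq M l := by
  have := (hM.1 l).ne'
  have h2 : (l.factorial : ℝ) ≠ 0 := by positivity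
  unfold muSeq nuSeq NSeq
  rw [Nat.factorial_succ]; push_cast; field_simp

lemma IsWeight.nuSeq_zero (hM : IsWeight M) : nuSeq M 0 = 1 := by
  simp [nuSeq, NSeq, hM.2.1, hM.2.2]

lemma IsWeight.one_le_nuSeq (hM : IsWeight M) (h1 : CondH1 M) (l : ℕ) : 1 ≤ nuSeq M l :=
  hM.nuSeq_zero ▸ h1 (Nat.zero_le l)

lemma IsWeight.muSeq_mono (hM : IsWeight M) (h1 : CondH1 M) : Monotone (muSeq M) := by
  intro a b hab
  rw [hM.muSeq_eq, hM.muSeq_eq]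
  have := hM.one_le_nuSeq h1 a
  have := h1 hab
  have hc : (a : ℝ) ≤ b := by exact_mod_cast hab
  gcongr

lemma IsWeight.factorial_le (hM : IsWeight M) (h1 : CondH1 M) (l : ℕ) :
    (l.factorial : ℝ) ≤ M l := by
  induction l with
  | zero => simp [hM.2.1]
  | succ l ih =>
    rw [← hM.mul_muSeq, hM.muSeq_eq, Nat.factorial_succ]
    push_cast
    have := hM.one_le_nuSeq h1 l
    have := (hM.1 l).le
    calc ((l : ℝ) + 1) * l.factorial = l.factorial * ((l + 1) * 1) := by ring
      _ ≤ _ := by gcongr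

/-- Monotonicity of `μ` gives the log-convexity of `M`; with `M_0 = 1` this makes the class an
algebra, see `DerivBound.mul`. -/
lemma IsWeight.mul_le (hM : IsWeight M) (h1 : CondH1 M) (i j : ℕ) : M i * M j ≤ M (i + j) := by
  induction j with
  | zero => simp [hM.2.1]
  | succ j ih =>
    rw [← hM.mul_muSeq j, ← add_assoc, ← hM.mul_muSeq (i + j), ← mul_assoc]
    have := hM.muSeq_mono h1 (Nat.le_add_left j i)
    have := hM.muSeq_pos j
    have := hM.1 (i + j)
    gcongr

lemma IsWeight.prod_muSeq (hM : IsWeight M) (m : ℕ) : ∏ i ∈ Finset.range m, muSeq M i = M m := by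
  induction m with
  | zero => simp [hM.2.1]
  | succ m ih => rw [Finset.prod_range_succ, ih, hM.mul_muSeq]

lemma IsWeight.bddAbove (hM : IsWeight M) (h1 : CondH1 M) {y : ℝ} (hy : 0 ≤ y) :
    BddAbove (Set.range fun l : ℕ => y ^ l / M l) := by
  refine ⟨Real.exp y, ?_⟩
  rintro _ ⟨l, rfl⟩
  refine le_trans ?_ (Real.pow_div_factorial_le_exp y hy l)
  have := hM.factorial_le h1 l
  dsimp only
  gcongr

lemma IsWeight.le_weightSup (hM : IsWeight M) (h1 : CondH1 M) {y : ℝ} (hy : 0 ≤ y) (l : ℕ) :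
    y ^ l / M l ≤ weightSup M y := le_ciSup (hM.bddAbove h1 hy) l

lemma IsWeight.one_le_weightSup (hM : IsWeight M) (h1 : CondH1 M) {y : ℝ} (hy : 0 ≤ y) :
    1 ≤ weightSup M y := by
  simpa [hM.2.1] using hM.le_weightSup h1 hy 0

lemma IsWeight.pow_le_weightSup (hM : IsWeight M) (h1 : CondH1 M) {y : ℝ} (hy : 0 ≤ y) (l : ℕ) :
    y ^ l ≤ weightSup M y * M l := by
  have := hM.le_weightSup h1 hy l
  rwa [div_le_iff₀ (hM.1 l)] at this

lemma IsWeight.exp_two_Omega (hM : IsWeight M) (h1 : CondH1 M) {y : ℝ} (hy : 0 ≤ y) :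
    Real.exp (2 * Omega M y) = weightSup M y ^ 2 := by
  have : 0 < weightSup M y := lt_of_lt_of_le one_pos (hM.one_le_weightSup h1 hy)
  rw [show (2 : ℝ) * Omega M y = Omega M y + Omega M y by ring, Real.exp_add]
  have : Real.exp (Omega M y) = weightSup M y := Real.exp_log this
  rw [this, sq]

lemma IsWeight.muSeq_le_geometric (hM : IsWeight M) (h2 : CondH2 M) {b : ℝ} (hb : 1 < b) :
    ∃ C : ℝ, 0 < C ∧ ∀ l, muSeq M l ≤ C * b ^ l := by
  have hlb : 0 < Real.log b := Real.log_pos hb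
  have hev : ∀ᶠ l : ℕ in atTop, muSeq M l ≤ b ^ l := by
    filter_upwards [h2.eventually_lt_const hlb, eventually_gt_atTop 0] with l hl hl0
    have hl0' : (0 : ℝ) < l := by exact_mod_cast hl0
    have : Real.log (muSeq M l) ≤ l * Real.log b := by
      rw [inv_mul_lt_iff₀ hl0'] at hl
      linarith
    rw [← Real.log_pow] at this
    exact (Real.log_le_log_iff (hM.muSeq_pos l) (by positivity)).1 this
  obtain ⟨L, hL⟩ := eventually_atTop.1 hev
  have hnn : ∀ i ∈ Finset.range L, 0 ≤ muSeq M i := fun i _ => (hM.muSeq_pos i).le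
  refine ⟨1 + ∑ i ∈ Finset.range L, muSeq M i, by
    have := Finset.sum_nonneg hnn; linarith, fun l => ?_⟩
  have h1l : 1 ≤ b ^ l := one_le_pow₀ hb.le
  have hs := Finset.sum_nonneg hnn
  rcases lt_or_ge l L with h | h
  · have := Finset.single_le_sum hnn (Finset.mem_range.2 h)
    nlinarith
  · have := hL l h
    nlinarith

lemma IsWeight.add_le_geometric (hM : IsWeight M) (h2 : CondH2 M) (r : ℕ) :
    ∀ b : ℝ, 1 < b → ∃ C : ℝ, 0 < C ∧ ∀ l, M (l + r) ≤ C * b ^ l * M l := by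
  induction r with
  | zero => exact fun b hb => ⟨1, one_pos, fun l => by
      have := one_le_pow₀ hb.le (n := l); have := hM.1 l; simp only [add_zero]; nlinarith⟩
  | succ r ih =>
    intro b hb
    -- The rate is split: one factor `√b` for the first `r` ratios, the other for the new one.
    have hb' : 1 < √b := Real.lt_sqrt_of_sq_lt (by simpa using hb)
    obtain ⟨C, hC, h⟩ := ih _ hb'
    obtain ⟨C', hC', h'⟩ := hM.muSeq_le_geometric h2 hb'
    refine ⟨C * C' * √b ^ r, by positivity, fun l => ?_⟩
    rw [← add_assoc, ← hM.mul_muSeq]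
    have e : b ^ l = √b ^ l * √b ^ l := by
      rw [← mul_pow, Real.mul_self_sqrt (by linarith)]
    have := hM.1 l
    calc M (l + r) * muSeq M (l + r) ≤ (C * √b ^ l * M l) * (C' * √b ^ (l + r)) := by
          gcongr
          · exact (hM.muSeq_pos _).le
          · exact h l
          · exact h' _
      _ = _ := by rw [e, pow_add]; ring

/-- Condition (H2) lets a dilation of the argument of `S` absorb any polynomial factor. -/
lemma IsWeight.eventually_mul_weightSup_le (hM : IsWeight M) (h1 : CondH1 M) (h2 : CondH2 M)
    (K : ℝ) (k : ℕ) :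
    ∀ᶠ y : ℝ in atTop, K * y ^ k * weightSup M y ≤ weightSup M (2 * y) := by
  -- Comparing the term `l` with the term `l + k + 1` gains `y^(k+1)`: `k` powers form the
  -- polynomial factor and the last one absorbs `|K| C`. The loss `2^l` is covered by the dilation
  -- of `y`.
  obtain ⟨C, hC, h⟩ := hM.add_le_geometric h2 (k + 1) 2 one_lt_two
  filter_upwards [eventually_ge_atTop (|K| * C), eventually_gt_atTop 0] with y hy hy0
  have hS : 0 < weightSup M (2 * y) :=
    lt_of_lt_of_le one_pos (hM.one_le_weightSup h1 (by positivity))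
  have key : ∀ l, |K| * y ^ k * (y ^ l / M l) ≤ weightSup M (2 * y) := by
    intro l
    refine le_trans ?_ (hM.le_weightSup h1 (by positivity) (l + (k + 1)))
    have hl := hM.1 l
    have hlk := hM.1 (l + (k + 1))
    rw [← mul_div_assoc, div_le_div_iff₀ hl hlk]
    have h1k : (1 : ℝ) ≤ 2 ^ (k + 1) := one_le_pow₀ one_le_two
    calc |K| * y ^ k * y ^ l * M (l + (k + 1)) ≤ |K| * y ^ k * y ^ l * (C * 2 ^ l * M l) := by
          gcongr; exact h l
      _ = (|K| * C) * (y ^ k * y ^ l * 2 ^ l * 1 * M l) := by ring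
      _ ≤ y * (y ^ k * y ^ l * 2 ^ l * 2 ^ (k + 1) * M l) := by gcongr
      _ = _ := by rw [mul_pow, pow_add, pow_add y, pow_succ y]; ring
  have hy1 : 0 ≤ |K| * y ^ k := by positivity
  calc K * y ^ k * weightSup M y ≤ |K| * y ^ k * weightSup M y := by
        have := hM.one_le_weightSup h1 hy0.le
        gcongr; exact le_abs_self K
    _ = ⨆ l, |K| * y ^ k * (y ^ l / M l) := Real.mul_iSup_of_nonneg hy1 _
    _ ≤ _ := ciSup_le key

end Weight

/-! ### Smoothing by infinitely many averages. -/

section Mollifier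

/-- The mean of `u` over the interval `[x - a, x + a]`. -/
noncomputable def windowMean (a : ℝ) (u : ℝ → ℝ) (x : ℝ) : ℝ := (∫ t in (-1 : ℝ)..1, u (x + a * t)) / 2

/-- `φ` averaged successively over windows of half-lengths `a_{m+j-1}, …, a_m`. -/
noncomputable def iterMean (a : ℕ → ℝ) (φ : ℝ → ℝ) : ℕ → ℕ → ℝ → ℝ
  | 0, _ => φ
  | j + 1, m => windowMean (a m) (iterMean a φ j (m + 1))

/-- Two windows and two functions are allowed so that one estimate covers Lipschitz bounds,
convergence and sup bounds; a window of length `0` returns the function itself. -/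
lemma abs_windowMean_sub_le {a b x y C : ℝ} {u w : ℝ → ℝ} (hu : Continuous u) (hw : Continuous w)
    (h : ∀ t ∈ Set.Icc (-1 : ℝ) 1, |u (x + a * t) - w (y + b * t)| ≤ C) :
    |windowMean a u x - windowMean b w y| ≤ C := by
  unfold windowMean
  rw [← sub_div, ← intervalIntegral.integral_sub (by apply Continuous.intervalIntegrable; fun_prop)
    (by apply Continuous.intervalIntegrable; fun_prop), abs_div, abs_two]
  have := intervalIntegral.norm_integral_le_of_norm_le_const (a := (-1 : ℝ)) (b := 1) (C := C)
    (f := fun t => u (x + a * t) - w (y + b * t)) (fun t ht => by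
      rw [Set.uIoc_of_le (by norm_num)] at ht
      exact h t ⟨ht.1.le, ht.2⟩)
  rw [Real.norm_eq_abs, show |(1 : ℝ) - -1| = 2 by norm_num] at this
  linarith

lemma windowMean_zero (u : ℝ → ℝ) (x : ℝ) : windowMean 0 u x = u x := by
  simp [windowMean]; ring

lemma windowMean_congr {a x y b : ℝ} {u w : ℝ → ℝ}
    (h : ∀ t ∈ Set.Icc (-1 : ℝ) 1, u (x + a * t) = w (y + b * t)) :
    windowMean a u x = windowMean b w y := by
  unfold windowMean
  rw [intervalIntegral.integral_congr (g := fun t => w (y + b * t))]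
  intro t ht
  rw [Set.uIcc_of_le (by norm_num)] at ht
  exact h t ht

lemma windowMean_affine (a x α β : ℝ) : windowMean a (fun y => α + β * y) x = α + β * x := by
  unfold windowMean
  have : ∀ t : ℝ, α + β * (x + a * t) = (α + β * x) + β * a * t := fun t => by ring
  simp_rw [this]
  rw [intervalIntegral.integral_add (by simp) (by
    apply Continuous.intervalIntegrable; fun_prop), intervalIntegral.integral_const_mul]
  simp; ring

lemma windowMean_neg {a x : ℝ} {u : ℝ → ℝ} (hu : ∀ y, u (-y) = u y) :
    windowMean a u (-x) = windowMean a u x := by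
  unfold windowMean
  have := intervalIntegral.integral_comp_neg (a := (-1 : ℝ)) (b := 1) (fun t => u (-x + a * t))
  simp only [neg_neg] at this
  rw [← this]
  congr 1
  apply intervalIntegral.integral_congr
  intro t _
  simp only
  rw [← hu]; congr 1; ring

/-- A derivative of a mean is a difference quotient of the averaged function: it costs a factor
`1/a` and no regularity. -/
lemma hasDerivAt_windowMean {a : ℝ} (ha : 0 < a) {u : ℝ → ℝ} (hu : Continuous u) (x : ℝ) :
    HasDerivAt (windowMean a u) ((2 * a)⁻¹ * (u (x + a) - u (x - a))) x := by
  have e : windowMean a u = fun y =>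
      (2 * a)⁻¹ * ((∫ t in (0 : ℝ)..(y + a), u t) - ∫ t in (0 : ℝ)..(y - a), u t) := by
    funext y
    unfold windowMean
    rw [intervalIntegral.integral_interval_sub_left (hu.intervalIntegrable _ _)
      (hu.intervalIntegrable _ _), intervalIntegral.integral_comp_add_mul u ha.ne']
    rw [smul_eq_mul]
    ring_nf
  rw [e]
  have h1 : HasDerivAt (fun y => ∫ t in (0 : ℝ)..y, u t) (u (x + a)) (x + a) :=
    intervalIntegral.integral_hasDerivAt_right (hu.intervalIntegrable _ _)
      (hu.stronglyMeasurableAtFilter _ _) hu.continuousAt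
  have h2 : HasDerivAt (fun y => ∫ t in (0 : ℝ)..y, u t) (u (x - a)) (x - a) :=
    intervalIntegral.integral_hasDerivAt_right (hu.intervalIntegrable _ _)
      (hu.stronglyMeasurableAtFilter _ _) hu.continuousAt
  exact ((h1.comp_add_const x a).sub (h2.comp_sub_const x a)).const_mul _

variable {a : ℕ → ℝ} {φ : ℝ → ℝ} {L : ℝ}

lemma abs_iterMean_sub_le (hL : ∀ x y, |φ x - φ y| ≤ L * |x - y|) (j : ℕ) :
    ∀ m x y, |iterMean a φ j m x - iterMean a φ j m y| ≤ L * |x - y| := by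
  have cont : ∀ u : ℝ → ℝ, (∀ x y, |u x - u y| ≤ L * |x - y|) → Continuous u := fun u hu =>
    (LipschitzWith.of_dist_le' (K := L) hu).continuous
  induction j with
  | zero => intro m; exact hL
  | succ j ih =>
    intro m x y
    refine abs_windowMean_sub_le (cont _ (ih _)) (cont _ (ih _)) fun t _ => ?_
    refine (ih _ _ _).trans_eq ?_
    congr 2; ring

lemma continuous_of_abs_sub_le {u : ℝ → ℝ} (hu : ∀ x y, |u x - u y| ≤ L * |x - y|) :
    Continuous u := (LipschitzWith.of_dist_le' (K := L) hu).continuous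

/-- The additional window is the innermost one, applied directly to `φ`; it moves `φ` by at most `L`
times its length, and the outer averages do not increase the difference. -/
lemma abs_iterMean_succ_sub_le (ha : ∀ i, 0 < a i) (hL0 : 0 ≤ L)
    (hL : ∀ x y, |φ x - φ y| ≤ L * |x - y|) (j : ℕ) :
    ∀ m x, |iterMean a φ j m x - iterMean a φ (j + 1) m x| ≤ L * a (m + j) := by
  induction j with
  | zero =>
    intro m x
    have hc := continuous_of_abs_sub_le hL
    conv_lhs => rw [iterMean, iterMean, ← windowMean_zero φ x]
    refine abs_windowMean_sub_le hc hc fun t ht => (hL _ _).trans ?_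
    gcongr
    rw [show x + 0 * t - (x + a m * t) = a m * (-t) by ring, abs_mul, abs_of_pos (ha m), abs_neg]
    exact mul_le_of_le_one_right (ha m).le (abs_le.2 ht)
  | succ j ih =>
    intro m x
    refine abs_windowMean_sub_le (continuous_of_abs_sub_le (abs_iterMean_sub_le hL _ _))
      (continuous_of_abs_sub_le (abs_iterMean_sub_le hL _ _)) fun t ht => ?_
    refine (ih _ _).trans_eq ?_
    congr 2; ring

lemma iterMean_nonneg (h : ∀ x, 0 ≤ φ x) (j : ℕ) : ∀ m x, 0 ≤ iterMean a φ j m x := by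
  induction j with
  | zero => intro m; exact h
  | succ j ih =>
    intro m x
    exact div_nonneg (intervalIntegral.integral_nonneg (by norm_num) fun t _ => ih _ _) zero_le_two

lemma abs_iterMean_le (hL : ∀ x y, |φ x - φ y| ≤ L * |x - y|) (h : ∀ x, |φ x| ≤ 1) (j : ℕ) :
    ∀ m x, |iterMean a φ j m x| ≤ 1 := by
  induction j with
  | zero => intro m; exact h
  | succ j ih =>
    intro m x
    have := abs_windowMean_sub_le (a := a m) (b := 0) (x := x) (y := 0) (w := fun _ => 0) (C := 1)
      (continuous_of_abs_sub_le (abs_iterMean_sub_le hL j (m + 1))) continuous_const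
      (fun t _ => by simpa using ih _ _)
    rw [windowMean_zero] at this
    simpa [iterMean] using this

lemma iterMean_add_period {c : ℝ} (h : ∀ x, φ (x + c) = φ x) (j : ℕ) :
    ∀ m x, iterMean a φ j m (x + c) = iterMean a φ j m x := by
  induction j with
  | zero => intro m; exact h
  | succ j ih =>
    intro m x
    refine windowMean_congr fun t _ => ?_
    rw [← ih (m + 1) (x + a m * t)]; congr 1; ring

lemma iterMean_neg (h : ∀ x, φ (-x) = φ x) (j : ℕ) :
    ∀ m x, iterMean a φ j m (-x) = iterMean a φ j m x := by
  induction j with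
  | zero => intro m; exact h
  | succ j ih => exact fun m x => windowMean_neg (ih _)

/-- Symmetric windows fix affine functions; the domain of validity shrinks by the total length of
the windows. -/
lemma iterMean_affine (ha : ∀ i, 0 < a i) {x r α β : ℝ}
    (h : ∀ y, |y - x| ≤ r → φ y = α + β * y) (j : ℕ) :
    ∀ m y, |y - x| ≤ r - ∑ i ∈ Finset.range j, a (m + i) → iterMean a φ j m y = α + β * y := by
  induction j with
  | zero => intro m y hy; exact h y (by simpa using hy)
  | succ j ih =>
    intro m y hy
    rw [← windowMean_affine (a m) y α β]
    refine windowMean_congr fun t ht => ih _ _ ?_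
    rw [Finset.sum_range_succ'] at hy
    have e : ∀ i, a (m + 1 + i) = a (m + (i + 1)) := fun i => by congr 1; ring
    simp_rw [e]
    have h1 : |a m * t| ≤ a m := by
      rw [abs_mul, abs_of_pos (ha m)]
      exact mul_le_of_le_one_right (ha m).le (abs_le.2 ht)
    have h2 : |y + a m * t - x| ≤ |y - x| + |a m * t| := by
      rw [show y + a m * t - x = (y - x) + a m * t by ring]; exact abs_add_le _ _
    simp only [add_zero] at hy
    linarith

lemma iteratedDeriv_windowed {v : ℕ → ℝ → ℝ} (hs : ∀ k : ℕ, ∀ m, ContDiff ℝ k (v m))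
    (hd : ∀ m x, deriv (v m) x = (2 * a m)⁻¹ * (v (m + 1) (x + a m) - v (m + 1) (x - a m)))
    (k m : ℕ) (x : ℝ) :
    iteratedDeriv (k + 1) (v m) x = (2 * a m)⁻¹ *
      (iteratedDeriv k (v (m + 1)) (x + a m) - iteratedDeriv k (v (m + 1)) (x - a m)) := by
  have e : deriv (v m) =
      fun x => (2 * a m)⁻¹ * (v (m + 1) (x + a m) - v (m + 1) (x - a m)) := funext (hd m)
  have hp : ContDiff ℝ k fun x => v (m + 1) (x + a m) :=
    (hs k (m + 1)).comp (contDiff_id.add contDiff_const)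
  have hn : ContDiff ℝ k fun x => v (m + 1) (x - a m) :=
    (hs k (m + 1)).comp (contDiff_id.sub contDiff_const)
  rw [iteratedDeriv_succ', e, iteratedDeriv_const_mul_field,
    iteratedDeriv_fun_sub hp.contDiffAt hn.contDiffAt]
  rw [iteratedDeriv_comp_add_const, iteratedDeriv_comp_sub_const]

/-- Averaging over infinitely many windows of summable lengths produces a smooth function whose
derivatives are controlled by the lengths of the windows. -/
theorem exists_mollification (ha : ∀ i, 0 < a i) (hsum : Summable a) (hL0 : 0 ≤ L)
    (hL : ∀ x y, |φ x - φ y| ≤ L * |x - y|) (hφ : ∀ x, |φ x| ≤ 1) :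
    ∃ v : ℝ → ℝ, ContDiff ℝ ∞ v ∧
      (∀ k x, |iteratedDeriv k v x| ≤ ∏ i ∈ Finset.range k, (a i)⁻¹) ∧
      (∀ x α β, (∀ y, |y - x| ≤ ∑' i, a i → φ y = α + β * y) → v x = α + β * x) ∧
      (∀ c, (∀ x, φ (x + c) = φ x) → ∀ x, v (x + c) = v x) ∧
      ((∀ x, φ (-x) = φ x) → ∀ x, v (-x) = v x) ∧
      ((∀ x, 0 ≤ φ x) → ∀ x, 0 ≤ v x) := by
  have hlim : ∀ m x, ∃ l, Tendsto (fun j => iterMean a φ j m x) atTop (𝓝 l) := by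
    intro m x
    refine cauchySeq_tendsto_of_complete (cauchySeq_of_dist_le_of_summable (fun j => L * a (m + j))
      (fun j => abs_iterMean_succ_sub_le ha hL0 hL j m x) ?_)
    exact (hsum.comp_injective (add_right_injective m)).mul_left L
  choose v hv using hlim
  have hvL : ∀ m x y, |v m x - v m y| ≤ L * |x - y| := fun m x y =>
    le_of_tendsto ((hv m x).sub (hv m y)).abs
      (Eventually.of_forall fun j => abs_iterMean_sub_le hL j m x y)
  have hvc : ∀ m, Continuous (v m) := fun m => continuous_of_abs_sub_le (hvL m)
  have hvb : ∀ m x, |v m x| ≤ 1 := fun m x =>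
    le_of_tendsto (hv m x).abs (Eventually.of_forall fun j => abs_iterMean_le hL hφ j m x)
  -- The limits for all starting indices are kept together: each is a mean of the next, so
  -- differentiating `v m` leads to `v (m + 1)`, and smoothness and bounds follow by induction on
  -- the order for all `m` at once.
  have hvm : ∀ m, v m = windowMean (a m) (v (m + 1)) := by
    intro m; funext x
    refine tendsto_nhds_unique ((tendsto_add_atTop_iff_nat 1).2 (hv m x)) ?_
    simp only [iterMean, windowMean]
    refine Tendsto.div_const ?_ 2
    refine intervalIntegral.tendsto_integral_filter_of_dominated_convergence (fun _ => 1)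
      (Eventually.of_forall fun j => ?_) (Eventually.of_forall fun j => ?_) (by simp) ?_
    · have := continuous_of_abs_sub_le (abs_iterMean_sub_le (a := a) hL j (m + 1))
      exact Continuous.aestronglyMeasurable (by fun_prop)
    · exact MeasureTheory.ae_of_all _ fun t _ => abs_iterMean_le hL hφ j _ _
    · exact MeasureTheory.ae_of_all _ fun t _ => hv _ _
  have hd : ∀ m x, HasDerivAt (v m)
      ((2 * a m)⁻¹ * (v (m + 1) (x + a m) - v (m + 1) (x - a m))) x := by
    intro m x
    conv => enter [1]; rw [hvm m]
    exact hasDerivAt_windowMean (ha m) (hvc _) x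
  have hs : ∀ k : ℕ, ∀ m, ContDiff ℝ k (v m) := by
    intro k
    induction k with
    | zero => exact fun m => contDiff_zero.2 (hvc m)
    | succ k ih =>
      intro m
      rw [show ((k + 1 : ℕ) : ℕ∞ω) = (k : ℕ∞ω) + 1 by norm_cast, contDiff_succ_iff_deriv]
      refine ⟨fun x => (hd m x).differentiableAt, by simp, ?_⟩
      rw [show deriv (v m) = _ from funext fun x => (hd m x).deriv]
      exact contDiff_const.mul (((ih _).comp (contDiff_id.add contDiff_const)).sub
        ((ih _).comp (contDiff_id.sub contDiff_const)))
  have hb : ∀ k m x, |iteratedDeriv k (v m) x| ≤ ∏ i ∈ Finset.range k, (a (m + i))⁻¹ := by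
    intro k
    induction k with
    | zero => intro m x; simpa using hvb m x
    | succ k ih =>
      intro m x
      rw [iteratedDeriv_windowed hs (fun m x => (hd m x).deriv), Finset.prod_range_succ', abs_mul,
        abs_of_pos (inv_pos.2 (mul_pos two_pos (ha m)))]
      have e : ∀ i, a (m + (i + 1)) = a (m + 1 + i) := fun i => by congr 1; ring
      simp_rw [e]
      have h1 := ih (m + 1) (x + a m)
      have h2 := ih (m + 1) (x - a m)
      have h3 := abs_sub (iteratedDeriv k (v (m + 1)) (x + a m))
        (iteratedDeriv k (v (m + 1)) (x - a m))
      have h4 := inv_pos.2 (ha m)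
      rw [mul_inv, add_zero]
      nlinarith
  refine ⟨v 0, contDiff_infty.2 fun k => hs k 0, fun k x => by simpa using hb k 0 x, ?_, ?_, ?_, ?_⟩
  · intro x α β h
    refine tendsto_nhds_unique (hv 0 x) (tendsto_const_nhds.congr fun j => ?_)
    refine (iterMean_affine ha h j 0 x ?_).symm
    simp only [sub_self, abs_zero, zero_add, sub_nonneg]
    exact hsum.sum_le_tsum _ fun i _ => (ha i).le
  · intro c h x
    refine tendsto_nhds_unique (hv 0 (x + c)) ((hv 0 x).congr fun j => ?_)
    exact (iterMean_add_period h j 0 x).symm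
  · intro h x
    refine tendsto_nhds_unique (hv 0 (-x)) ((hv 0 x).congr fun j => ?_)
    exact (iterMean_neg h j 0 x).symm
  · exact fun h x => ge_of_tendsto' (hv 0 x) fun j => iterMean_nonneg h j 0 x

end Mollifier

/-- The window lengths that produce a bump in the class defined by `M`. -/
theorem IsWeight.exists_windows {M : ℕ → ℝ} (hM : IsWeight M) (h3 : CondH3 M) {σ r : ℝ}
    (hσ : 0 < σ) (hr : 0 < r) :
    ∃ (a : ℕ → ℝ) (B : ℝ), (∀ i, 0 < a i) ∧ Summable a ∧ ∑' i, a i ≤ r ∧ 1 ≤ B ∧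
      ∀ k, ∏ i ∈ Finset.range k, (a i)⁻¹ ≤ B * σ ^ k * M k := by
  -- With these lengths the product of the inverses is exactly `σ^k M_k`, and (H3) is their
  -- summability.
  set b : ℕ → ℝ := fun i => (σ * muSeq M i)⁻¹ with hb
  have hbpos : ∀ i, 0 < b i := fun i => inv_pos.2 (mul_pos hσ (hM.muSeq_pos i))
  have hbs : Summable b := by
    have : b = fun i => σ⁻¹ * (M i / M (i + 1)) := by
      funext i; simp only [hb, muSeq, mul_inv, inv_div]
    rw [this]; exact h3.mul_left _
  obtain ⟨L, hL⟩ := ((tendsto_sum_nat_add b).eventually_lt_const (half_pos hr)).exists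
  have hS0 : 0 ≤ ∑ i ∈ Finset.range L, b i := Finset.sum_nonneg fun i _ => (hbpos i).le
  set S := ∑ i ∈ Finset.range L, b i with hS
  -- The tail is already shorter than `r/2`; only the first `L` windows are shrunk, which costs the
  -- constant `B = ρ^(-L)` uniformly in `k`.
  obtain ⟨ρ, hρ0, hρ1, hρS⟩ : ∃ ρ : ℝ, 0 < ρ ∧ ρ ≤ 1 ∧ ρ * S ≤ r / 2 := by
    refine ⟨min 1 (r / (2 * (S + 1))), by positivity, min_le_left _ _, ?_⟩
    calc min 1 (r / (2 * (S + 1))) * S ≤ r / (2 * (S + 1)) * S := by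
          gcongr; exact min_le_right _ _
      _ ≤ r / 2 := by
          rw [div_mul_eq_mul_div, div_le_div_iff₀ (by positivity) two_pos]; nlinarith
  set ρs : ℕ → ℝ := fun i => if i < L then ρ else 1 with hρs
  have hρpos : ∀ i, 0 < ρs i := fun i => by simp only [hρs]; split_ifs <;> linarith
  have hρle : ∀ i, ρs i ≤ 1 := fun i => by simp only [hρs]; split_ifs <;> linarith
  have hsum : Summable fun i => ρs i * b i :=
    hbs.of_nonneg_of_le (fun i => (mul_pos (hρpos i) (hbpos i)).le)
      fun i => mul_le_of_le_one_left (hbpos i).le (hρle i)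
  refine ⟨fun i => ρs i * b i, (ρ⁻¹) ^ L, fun i => mul_pos (hρpos i) (hbpos i), hsum, ?_,
    one_le_pow₀ ((one_le_inv₀ hρ0).2 hρ1), fun k => ?_⟩
  · rw [← hsum.sum_add_tsum_nat_add L]
    have e1 : ∑ i ∈ Finset.range L, ρs i * b i = ρ * S := by
      rw [hS, Finset.mul_sum]
      refine Finset.sum_congr rfl fun i hi => ?_
      simp [hρs, Finset.mem_range.1 hi]
    have e2 : ∑' i, ρs (i + L) * b (i + L) = ∑' i, b (i + L) := by
      refine tsum_congr fun i => ?_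
      simp [hρs]
    rw [e1, e2]; linarith
  · have e : ∀ i, (ρs i * b i)⁻¹ = (ρs i)⁻¹ * σ * muSeq M i := fun i => by
      simp only [hb, mul_inv, inv_inv]; ring
    simp_rw [e]
    rw [Finset.prod_mul_distrib, Finset.prod_mul_distrib, hM.prod_muSeq, Finset.prod_const,
      Finset.card_range]
    have := hM.1 k
    gcongr
    have h1 : ∀ i, 1 ≤ (ρs i)⁻¹ := fun i => (one_le_inv₀ (hρpos i)).2 (hρle i)
    have h2 : ∏ i ∈ Finset.range L, (ρs i)⁻¹ = (ρ⁻¹) ^ L := by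
      rw [Finset.prod_congr rfl (g := fun _ => ρ⁻¹), Finset.prod_const, Finset.card_range]
      intro i hi; simp [hρs, Finset.mem_range.1 hi]
    rcases le_total k L with hkL | hkL
    · rw [← h2]
      rw [← Finset.prod_range_mul_prod_Ico _ hkL]
      refine le_mul_of_one_le_right (Finset.prod_nonneg fun i _ => ?_)
        (Finset.one_le_prod fun i _ => h1 i)
      linarith [h1 i]
    · rw [← h2, Finset.prod_subset (Finset.range_mono hkL) fun i _ hi => ?_]
      have : ¬ i < L := by simpa using hi
      simp [hρs, this]

/-! ### Bumps and ramps in the class defined by `M`. -/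

section Bumps

/-- The distance to the nearest integer. -/
noncomputable def distInt (x : ℝ) : ℝ := |x - round x|

lemma distInt_nonneg (x : ℝ) : 0 ≤ distInt x := abs_nonneg _

lemma distInt_le_abs_sub (x : ℝ) (m : ℤ) : distInt x ≤ |x - m| := round_le x m

lemma distInt_add_one (x : ℝ) : distInt (x + 1) = distInt x := by
  unfold distInt
  rw [round_add_one]; push_cast; congr 1; ring

lemma distInt_le_add (x y : ℝ) : distInt x ≤ distInt y + |x - y| := by
  refine (distInt_le_abs_sub x (round y)).trans ?_
  unfold distInt
  rw [show x - (round y : ℝ) = (y - round y) + (x - y) by ring]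
  exact abs_add_le _ _

lemma abs_distInt_sub_le (x y : ℝ) : |distInt x - distInt y| ≤ |x - y| := by
  rw [abs_le]
  have h1 := distInt_le_add x y
  have h2 := distInt_le_add y x
  rw [abs_sub_comm y x] at h2
  constructor <;> linarith

lemma distInt_eq_abs {x : ℝ} (h : |x| ≤ 1 / 2) : distInt x = |x| := by
  refine le_antisymm (by simpa using distInt_le_abs_sub x 0) ?_
  unfold distInt
  rcases eq_or_ne (round x) 0 with h0 | h0
  · simp [h0]
  · have : (1 : ℝ) ≤ |(round x : ℝ)| := by exact_mod_cast Int.one_le_abs h0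
    have h2 := abs_sub_abs_le_abs_sub (round x : ℝ) x
    rw [abs_sub_comm] at h2
    linarith

lemma distInt_le_half (x : ℝ) : distInt x ≤ 1 / 2 := abs_sub_round x

/-- The Lipschitz profile of the bump functions. -/
noncomputable def trapezoid (u : ℝ) : ℝ := max 0 (min 1 (32 * (7 / 64 - u)))

lemma trapezoid_nonneg (u : ℝ) : 0 ≤ trapezoid u := le_max_left _ _

lemma trapezoid_le_one (u : ℝ) : trapezoid u ≤ 1 := max_le zero_le_one (min_le_left _ _)

lemma abs_trapezoid_sub_le (u v : ℝ) : |trapezoid u - trapezoid v| ≤ 32 * |u - v| := by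
  unfold trapezoid
  refine (abs_max_sub_max_le_max _ _ _ _).trans (max_le (by simp) ?_)
  refine (abs_min_sub_min_le_max _ _ _ _).trans (max_le (by simp) ?_)
  rw [show 32 * (7 / 64 - u) - 32 * (7 / 64 - v) = 32 * (v - u) by ring, abs_mul, abs_sub_comm v u]
  norm_num

lemma trapezoid_eq_one {u : ℝ} (h : u ≤ 5 / 64) : trapezoid u = 1 := by
  unfold trapezoid
  rw [min_eq_left (by linarith), max_eq_right zero_le_one]

lemma trapezoid_eq_zero {u : ℝ} (h : 7 / 64 ≤ u) : trapezoid u = 0 := by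
  unfold trapezoid
  exact max_eq_left ((min_le_right _ _).trans (by linarith))

variable {M : ℕ → ℝ}

/-- A bump on the line, in the class defined by `M` with an arbitrarily small scale `σ`. -/
theorem IsWeight.exists_bump (hM : IsWeight M) (h3 : CondH3 M) {σ : ℝ} (hσ : 0 < σ) :
    ∃ (β : ℝ → ℝ) (B : ℝ), 1 ≤ B ∧ ContDiff ℝ ∞ β ∧
      (∀ k x, |iteratedDeriv k β x| ≤ B * σ ^ k * M k) ∧
      (∀ x, 0 ≤ β x) ∧ (∀ x, β x ≤ 1) ∧ (∀ x, β (-x) = β x) ∧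
      (∀ x, |x| ≤ 1 / 16 → β x = 1) ∧ ∀ x, 1 / 8 ≤ |x| → β x = 0 := by
  -- The trapezoid is constant below `5/64` and above `7/64`; windows of total length `1/64` leave
  -- the thresholds `4/64 = 1/16` and `8/64 = 1/8`.
  obtain ⟨a, B, ha, hs, hr, hB1, hB⟩ := hM.exists_windows h3 hσ (r := 1 / 64) (by norm_num)
  obtain ⟨v, hv, hvB, haff, -, heven, hpos⟩ := exists_mollification (φ := fun x => trapezoid |x|)
    (L := 32) ha hs (by norm_num)
    (fun x y => (abs_trapezoid_sub_le _ _).trans (mul_le_mul_of_nonneg_left (abs_abs_sub_abs_le_abs_sub x y) (by norm_num)))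
    (fun x => by rw [abs_of_nonneg (trapezoid_nonneg _)]; exact trapezoid_le_one _)
  refine ⟨v, B, hB1, hv, fun k x => (hvB k x).trans (hB k), hpos fun x => trapezoid_nonneg _,
    fun x => ?_, heven fun x => by simp, fun x hx => ?_, fun x hx => ?_⟩
  · simpa using (le_abs_self _).trans (hvB 0 x)
  · rw [haff x 1 0 fun y hy => ?_]
    · ring
    · rw [trapezoid_eq_one]
      · ring
      · have := abs_sub_abs_le_abs_sub y x
        linarith
  · rw [haff x 0 0 fun y hy => ?_]
    · ring
    · rw [trapezoid_eq_zero]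
      · ring
      · have := abs_sub_abs_le_abs_sub x y
        rw [abs_sub_comm] at this
        linarith

/-- A bump on the circle, in the class defined by `M` with an arbitrarily small scale `σ`. -/
theorem IsWeight.exists_periodic_bump (hM : IsWeight M) (h3 : CondH3 M) {σ : ℝ} (hσ : 0 < σ) :
    ∃ (b : ℝ → ℝ) (B : ℝ), 1 ≤ B ∧ ContDiff ℝ ∞ b ∧
      (∀ k x, |iteratedDeriv k b x| ≤ B * σ ^ k * M k) ∧
      (∀ x, 0 ≤ b x) ∧ (∀ x, b x ≤ 1) ∧ (∀ x, b (x + 1) = b x) ∧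
      (∀ x, distInt x ≤ 1 / 16 → b x = 1) ∧ ∀ x, 1 / 8 ≤ distInt x → b x = 0 := by
  obtain ⟨a, B, ha, hs, hr, hB1, hB⟩ := hM.exists_windows h3 hσ (r := 1 / 64) (by norm_num)
  obtain ⟨v, hv, hvB, haff, hper, -, hpos⟩ :=
    exists_mollification (φ := fun x => trapezoid (distInt x))
      (L := 32) ha hs (by norm_num)
      (fun x y => (abs_trapezoid_sub_le _ _).trans (mul_le_mul_of_nonneg_left (abs_distInt_sub_le x y) (by norm_num)))
      (fun x => by rw [abs_of_nonneg (trapezoid_nonneg _)]; exact trapezoid_le_one _)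
  refine ⟨v, B, hB1, hv, fun k x => (hvB k x).trans (hB k), hpos fun x => trapezoid_nonneg _,
    fun x => ?_, hper 1 fun x => by simp only [distInt_add_one], fun x hx => ?_, fun x hx => ?_⟩
  · simpa using (le_abs_self _).trans (hvB 0 x)
  · rw [haff x 1 0 fun y hy => ?_]
    · ring
    · rw [trapezoid_eq_one]
      · ring
      · have := distInt_le_add y x
        linarith
  · rw [haff x 0 0 fun y hy => ?_]
    · ring
    · rw [trapezoid_eq_zero]
      · ring
      · have := distInt_le_add x y
        rw [abs_sub_comm] at this
        linarith

/-- A function on the circle that is the identity near the origin, in the class defined by `M`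
with an arbitrarily small scale `σ`. -/
theorem IsWeight.exists_periodic_ramp (hM : IsWeight M) (h3 : CondH3 M) {σ : ℝ} (hσ : 0 < σ) :
    ∃ (w : ℝ → ℝ) (B : ℝ), 1 ≤ B ∧ ContDiff ℝ ∞ w ∧
      (∀ k x, |iteratedDeriv k w x| ≤ B * σ ^ k * M k) ∧
      (∀ x, |w x| ≤ 1) ∧ (∀ x, w (x + 1) = w x) ∧ ∀ x, |x| ≤ 3 / 16 → w x = x := by
  obtain ⟨a, B, ha, hs, hr, hB1, hB⟩ := hM.exists_windows h3 hσ (r := 1 / 64) (by norm_num)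
  -- This triangle wave is the identity on `|x| ≤ 1/4`, which leaves room for the windows around
  -- `|x| ≤ 3/16`.
  obtain ⟨v, hv, hvB, haff, hper, -, -⟩ :=
    exists_mollification (φ := fun x => distInt (x + 1 / 4) - 1 / 4)
      (L := 1) ha hs (by norm_num)
      (fun x y => by
        have := abs_distInt_sub_le (x + 1 / 4) (y + 1 / 4)
        simp only [sub_sub_sub_cancel_right, one_mul]
        simpa using this)
      (fun x => by
        have h1 := distInt_le_half (x + 1 / 4)
        have h2 := distInt_nonneg (x + 1 / 4)
        rw [abs_le]; constructor <;> linarith)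
  refine ⟨v, B, hB1, hv, fun k x => (hvB k x).trans (hB k), fun x => ?_, hper 1 fun x => ?_,
    fun x hx => ?_⟩
  · simpa using hvB 0 x
  · rw [show x + 1 + 1 / 4 = x + 1 / 4 + 1 by ring, distInt_add_one]
  · rw [haff x 0 1 fun y hy => ?_]
    · ring
    · have h1 := abs_le.1 hx
      have h2 := abs_le.1 (hy.trans hr)
      have h3 : 0 ≤ y + 1 / 4 := by linarith
      rw [distInt_eq_abs (by rw [abs_of_nonneg h3]; linarith), abs_of_nonneg h3]
      ring

end Bumps

/-! ### Calculus of derivative bounds. -/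

section DerivBound

variable {E : Type*} [NormedAddCommGroup E] [NormedSpace ℝ E]

/-- `F` is smooth and its derivatives of order `m` are bounded by `B σ^m W_m` on `S`. -/
structure DerivBound (S : Set E) (W : ℕ → ℝ) (F : E → ℝ) (B σ : ℝ) : Prop where
  smooth : ContDiff ℝ ∞ F
  bound : ∀ p ∈ S, ∀ m, ‖iteratedFDeriv ℝ m F p‖ ≤ B * σ ^ m * W m

variable {S : Set E} {W : ℕ → ℝ} {F G : E → ℝ} {B B' σ σ' : ℝ}

lemma DerivBound.mono (hF : DerivBound S W F B σ) (hW : ∀ m, 0 ≤ W m) (hσ : 0 ≤ σ)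
    (hB : 0 ≤ B') (h : B ≤ B') (hσ' : σ ≤ σ') : DerivBound S W F B' σ' :=
  ⟨hF.smooth, fun p hp m => (hF.bound p hp m).trans (by have := hW m; gcongr)⟩

lemma DerivBound.mul (hF : DerivBound S W F B σ) (hG : DerivBound S W G B' σ')
    (hW : ∀ m, 0 ≤ W m) (hmul : ∀ i j, W i * W j ≤ W (i + j)) (hB : 0 ≤ B) (hB' : 0 ≤ B')
    (hσ : 0 ≤ σ) (hσ' : 0 ≤ σ') :
    DerivBound S W (fun x => F x * G x) (B * B') (σ + σ') := by
  refine ⟨hF.smooth.mul hG.smooth, fun p hp m => ?_⟩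
  refine (norm_iteratedFDeriv_mul_le (N := ∞) hF.smooth hG.smooth p
    (by exact_mod_cast le_top)).trans ?_
  rw [add_pow, Finset.mul_sum, Finset.sum_mul]
  refine Finset.sum_le_sum fun i hi => ?_
  have him : i + (m - i) = m := Nat.add_sub_cancel' (Nat.lt_succ_iff.1 (Finset.mem_range.1 hi))
  have h1 := hF.bound p hp i
  have h2 := hG.bound p hp (m - i)
  have hWi := hW i
  have h3 : W i * W (m - i) ≤ W m := by simpa only [him] using hmul i (m - i)
  calc (m.choose i : ℝ) * ‖iteratedFDeriv ℝ i F p‖ * ‖iteratedFDeriv ℝ (m - i) G p‖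
      ≤ (m.choose i : ℝ) * (B * σ ^ i * W i) * (B' * σ' ^ (m - i) * W (m - i)) := by gcongr
    _ = B * B' * (σ ^ i * σ' ^ (m - i) * (m.choose i : ℝ)) * (W i * W (m - i)) := by ring
    _ ≤ _ := by gcongr

lemma DerivBound.add (hF : DerivBound S W F B σ) (hG : DerivBound S W G B' σ) :
    DerivBound S W (fun x => F x + G x) (B + B') σ := by
  refine ⟨hF.smooth.add hG.smooth, fun p hp m => ?_⟩
  have := iteratedFDeriv_add_apply (x := p) (i := m) (f := F) (g := G)
    (hF.smooth.contDiffAt.of_le (by exact_mod_cast le_top))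
    (hG.smooth.contDiffAt.of_le (by exact_mod_cast le_top))
  rw [show (fun x => F x + G x) = F + G from rfl, this]
  refine (norm_add_le _ _).trans ((add_le_add (hF.bound p hp m) (hG.bound p hp m)).trans_eq ?_)
  ring

lemma DerivBound.const_mul (hF : DerivBound S W F B σ) (c : ℝ) :
    DerivBound S W (fun x => c * F x) (|c| * B) σ := by
  refine ⟨contDiff_const.mul hF.smooth, fun p hp m => ?_⟩
  have := iteratedFDeriv_const_smul_apply (x := p) (i := m) (f := F) (a := c)
    (hF.smooth.contDiffAt.of_le (by exact_mod_cast le_top))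
  rw [show (fun x => c * F x) = c • F from rfl, this, norm_smul, Real.norm_eq_abs]
  have := hF.bound p hp m
  calc |c| * ‖iteratedFDeriv ℝ m F p‖ ≤ |c| * (B * σ ^ m * W m) := by gcongr
    _ = _ := by ring

lemma DerivBound.sum {ι : Type*} (s : Finset ι) {F : ι → E → ℝ} {B : ι → ℝ}
    (h : ∀ i ∈ s, DerivBound S W (F i) (B i) σ) :
    DerivBound S W (fun x => ∑ i ∈ s, F i x) (∑ i ∈ s, B i) σ := by
  classical
  induction s using Finset.induction_on with
  | empty =>
    refine ⟨by simp only [Finset.sum_empty]; exact contDiff_const, fun p _ m => ?_⟩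
    simp only [Finset.sum_empty]
    rw [iteratedFDeriv_fun_zero]
    simp
  | insert i s hi ih =>
    simp only [Finset.sum_insert hi]
    exact (h i (Finset.mem_insert_self i s)).add
      (ih fun j hj => h j (Finset.mem_insert_of_mem hj))

/-- The weight `1` describes functions of exponential type, such as trigonometric polynomials. Their
products are estimated in this weight, and the passage to `M` is made only once. -/
lemma DerivBound.prod {ι : Type*} (s : Finset ι) {F : ι → E → ℝ} (hσ : 0 ≤ σ)
    (h : ∀ i ∈ s, DerivBound S (fun _ => 1) (F i) 1 σ) :
    DerivBound S (fun _ => 1) (fun x => ∏ i ∈ s, F i x) 1 (s.card * σ) := by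
  classical
  induction s using Finset.induction_on with
  | empty =>
    refine ⟨by simp only [Finset.prod_empty]; exact contDiff_const, fun p _ m => ?_⟩
    simp only [Finset.prod_empty]
    rcases m with _ | m
    · simp
    · rw [iteratedFDeriv_const_of_ne (Nat.succ_ne_zero m)]; simp
  | insert i s hi ih =>
    simp only [Finset.prod_insert hi, Finset.card_insert_of_notMem hi]
    have := (h i (Finset.mem_insert_self i s)).mul
      (ih fun j hj => h j (Finset.mem_insert_of_mem hj)) (fun _ => zero_le_one) (fun _ _ => by simp)
      zero_le_one zero_le_one hσ (by positivity)
    convert this using 1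
    · ring
    · push_cast; ring

lemma DerivBound.comp_linear {E' : Type*} [NormedAddCommGroup E'] [NormedSpace ℝ E']
    {f : E' → ℝ} (hf : DerivBound Set.univ W f B σ) (hW : ∀ m, 0 ≤ W m)
    (hB : 0 ≤ B) (hσ : 0 ≤ σ) (L : E →L[ℝ] E') {c : ℝ} (hL : ‖L‖ ≤ c) :
    DerivBound S W (fun x => f (L x)) B (c * σ) := by
  refine ⟨hf.smooth.comp L.contDiff, fun p _ m => ?_⟩
  have := L.iteratedFDeriv_comp_right (f := f) (i := m) (n := ∞) hf.smooth p
    (by exact_mod_cast le_top)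
  rw [show (fun x => f (L x)) = f ∘ L from rfl, this]
  refine (ContinuousMultilinearMap.norm_compContinuousLinearMap_le _ _).trans ?_
  rw [Finset.prod_const, Finset.card_univ, Fintype.card_fin, mul_pow]
  have h1 := hf.bound (L p) trivial m
  have h2 := hW m
  calc _ ≤ (B * σ ^ m * W m) * c ^ m := by gcongr
    _ = _ := by ring

lemma DerivBound.of_iteratedDeriv {f : ℝ → ℝ} (hf : ContDiff ℝ ∞ f)
    (h : ∀ m x, |iteratedDeriv m f x| ≤ B * σ ^ m * W m) : DerivBound Set.univ W f B σ :=
  ⟨hf, fun p _ m => by rw [norm_iteratedFDeriv_eq_norm_iteratedDeriv]; exact h m p⟩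

/-- This is where `Ω` enters: `K^m ≤ S(K/σ) σ^m M_m` by the definition of `S`, so a function of
exponential type `K` lies in the class at any scale `σ`, with constant `S(K/σ)`. -/
lemma DerivBound.of_one {M : ℕ → ℝ} {K : ℝ} (hM : IsWeight M) (h1 : CondH1 M)
    (hF : DerivBound S (fun _ => 1) F 1 K) (hK : 0 ≤ K) (hσ : 0 < σ) :
    DerivBound S M F (weightSup M (K / σ)) σ := by
  refine ⟨hF.smooth, fun p hp m => (hF.bound p hp m).trans ?_⟩
  have := hM.pow_le_weightSup h1 (y := K / σ) (by positivity) m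
  calc 1 * K ^ m * 1 = (K / σ) ^ m * σ ^ m := by
        rw [div_pow]; field_simp
    _ ≤ weightSup M (K / σ) * M m * σ ^ m := by gcongr
    _ = _ := by ring

/-- A bound on derivatives is inherited by a function that is locally a translate. -/
lemma DerivBound.of_local_translate {F G : E → ℝ} (hG : DerivBound Set.univ W G B σ)
    (h : ∀ p, ∃ q, F =ᶠ[𝓝 p] fun x => G (x - q)) : DerivBound S W F B σ := by
  refine ⟨contDiff_iff_contDiffAt.2 fun p => ?_, fun p _ m => ?_⟩
  · obtain ⟨q, hq⟩ := h p
    exact (hG.smooth.comp (contDiff_id.sub contDiff_const)).contDiffAt.congr_of_eventuallyEq hq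
  · obtain ⟨q, hq⟩ := h p
    rw [(hq.iteratedFDeriv ℝ m).eq_of_nhds, iteratedFDeriv_comp_sub]
    exact hG.bound _ trivial m

/-- Linear forms are unbounded, hence the restriction to a set `S`; it serves the unperturbed
Hamiltonian on `D`. -/
lemma DerivBound.linear {M : ℕ → ℝ} (hM : IsWeight M) (hσ : 0 < σ) (L : E →L[ℝ] ℝ) {c : ℝ}
    (hc : 0 ≤ c) (hL : ‖L‖ ≤ c) (hS : ∀ p ∈ S, |L p| ≤ c) :
    DerivBound S M L (max c (c / σ)) σ := by
  refine ⟨L.contDiff, fun p hp m => ?_⟩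
  rcases m with _ | _ | m
  · simpa [hM.2.1] using Or.inl (hS p hp)
  · rw [norm_iteratedFDeriv_one, L.fderiv, zero_add, pow_one, hM.2.2, mul_one]
    calc ‖L‖ ≤ c := hL
      _ = c / σ * σ := by field_simp
      _ ≤ _ := by gcongr; exact le_max_right _ _
  · have : iteratedFDeriv ℝ (m + 1 + 1) L p = 0 := by
      rw [← norm_eq_zero, ← norm_iteratedFDeriv_fderiv,
        show fderiv ℝ L = fun _ => L from funext fun _ => L.fderiv,
        iteratedFDeriv_const_of_ne (Nat.succ_ne_zero m)]
      simp
    rw [this, norm_zero]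
    have := (hM.1 (m + 1 + 1)).le
    positivity

end DerivBound

/-! ### From derivative bounds to the norm `|H|_s`. -/

section UltraNorm

variable {n : ℕ} {M : ℕ → ℝ} {s : ℝ}

lemma norm_dir_le (i : Fin (n + n)) : ‖(dir i : (Fin n → ℝ) × (Fin n → ℝ))‖ ≤ 1 := by
  have key : ∀ j : Fin n, ‖(Pi.single j 1 : Fin n → ℝ)‖ ≤ 1 := fun j => by
    rw [pi_norm_le_iff_of_nonneg zero_le_one]
    intro k
    by_cases h : k = j
    · subst h; simp
    · simp [h]
  refine Fin.addCases (fun j => ?_) (fun j => ?_) i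
  · rw [dir, Fin.append_left, dirTheta, Prod.norm_mk]
    exact max_le (key j) (by simp)
  · rw [dir, Fin.append_right, dirAction, Prod.norm_mk]
    exact max_le (by simp) (key j)

lemma abs_partialDeriv_le (k : Fin (n + n) → ℕ) (F : (Fin n → ℝ) × (Fin n → ℝ) → ℝ)
    (p : (Fin n → ℝ) × (Fin n → ℝ)) :
    |partialDeriv k F p| ≤ ‖iteratedFDeriv ℝ (∑ i, k i) F p‖ := by
  refine ((iteratedFDeriv ℝ (∑ i, k i) F p).le_opNorm _).trans ?_
  refine mul_le_of_le_one_right (norm_nonneg _) ?_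
  exact Finset.prod_le_one (fun _ _ => norm_nonneg _) fun _ _ => norm_dir_le _

/-- The factor `(|k|+1)²` of the norm is absorbed by working at a scale `σ` with `s σ ≤ 1/8`. -/
lemma add_one_sq_mul_pow_le (m : ℕ) : ((m : ℝ) + 1) ^ 2 * (1 / 8) ^ m ≤ 1 := by
  induction m with
  | zero => norm_num
  | succ m ih =>
    push_cast
    have h8 : (0 : ℝ) < (1 / 8) ^ m := by positivity
    have hm : (0 : ℝ) ≤ m := m.cast_nonneg
    calc ((m : ℝ) + 1 + 1) ^ 2 * (1 / 8) ^ (m + 1)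
        = ((m : ℝ) + 1 + 1) ^ 2 / 8 * (1 / 8) ^ m := by rw [pow_succ (1 / 8 : ℝ)]; ring
      _ ≤ ((m : ℝ) + 1) ^ 2 * (1 / 8) ^ m := by gcongr; nlinarith
      _ ≤ 1 := ih

lemma ultraNorm_le (hM : IsWeight M) (hs : 0 < s) {B σ : ℝ} (hB : 0 ≤ B) (hσ : 0 ≤ σ)
    (hsσ : s * σ ≤ 1 / 8) {H : Torus n → (Fin n → ℝ) → ℝ}
    (hH : DerivBound (Set.univ ×ˢ ballD n) M (lift H) B σ) :
    ultraNorm M s H ≤ ENNReal.ofReal (4 * Real.pi ^ 2 / 3 * B) := by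
  unfold ultraNorm
  rw [ENNReal.ofReal_mul (by positivity)]
  gcongr
  refine iSup_le fun x => iSup_le fun I => iSup_le fun hI => iSup_le fun k =>
    ENNReal.ofReal_le_ofReal ?_
  set m := ∑ i, k i
  have h1 := (abs_partialDeriv_le k (lift H) (x, I)).trans (hH.bound (x, I) ⟨trivial, hI⟩ m)
  have hm := hM.1 m
  rw [div_le_iff₀ hm]
  calc ((m : ℝ) + 1) ^ 2 * s ^ m * |partialDeriv k (lift H) (x, I)|
      ≤ ((m : ℝ) + 1) ^ 2 * s ^ m * (B * σ ^ m * M m) := by gcongr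
    _ = ((m : ℝ) + 1) ^ 2 * (s * σ) ^ m * (B * M m) := by rw [mul_pow]; ring
    _ ≤ ((m : ℝ) + 1) ^ 2 * (1 / 8) ^ m * (B * M m) := by gcongr
    _ ≤ 1 * (B * M m) := by gcongr; exact add_one_sq_mul_pow_le m
    _ = B * M m := one_mul _

lemma isUltraDiff_of_derivBound (hM : IsWeight M) (hs : 0 < s) {B σ : ℝ} (hB : 0 ≤ B)
    (hσ : 0 ≤ σ) (hsσ : s * σ ≤ 1 / 8) {H : Torus n → (Fin n → ℝ) → ℝ}
    (hH : DerivBound (Set.univ ×ˢ ballD n) M (lift H) B σ) : IsUltraDiff M s H :=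
  ⟨hH.smooth.contDiffOn, (ultraNorm_le hM hs hB hσ hsσ hH).trans_lt ENNReal.ofReal_lt_top⟩

end UltraNorm

/-! ### The kernels that select passages. -/

section Kernel

/-- The trigonometric polynomial `p⁻¹ ∑_{l<p} cos (2π l x)`, which vanishes at the fractions `k/p`
that are not integers. -/
noncomputable def cosKernel (p : ℕ) (x : ℝ) : ℝ :=
  (1 / (p : ℝ)) * ∑ l ∈ Finset.range p, Real.cos (2 * Real.pi * l * x)

variable {p : ℕ}

lemma derivBound_cosKernel (hp : 0 < p) :
    DerivBound Set.univ (fun _ => 1) (cosKernel p) 1 (2 * Real.pi * p) := by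
  have hp' : (0 : ℝ) < p := by exact_mod_cast hp
  have hterm : ∀ l ∈ Finset.range p, DerivBound Set.univ (fun _ => 1)
      (fun x : ℝ => Real.cos (2 * Real.pi * l * x)) 1 (2 * Real.pi * p) := by
    intro l hl
    have hlp : (l : ℝ) ≤ p := by exact_mod_cast (Finset.mem_range.1 hl).le
    refine .of_iteratedDeriv (Real.contDiff_cos.comp (contDiff_const.mul contDiff_id))
      fun m x => ?_
    rw [iteratedDeriv_comp_const_mul (f := Real.cos) Real.contDiff_cos]
    simp only [abs_mul, one_mul, mul_one]
    rw [abs_of_nonneg (by positivity)]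
    calc (2 * Real.pi * l) ^ m * |iteratedDeriv m Real.cos (2 * Real.pi * l * x)|
        ≤ (2 * Real.pi * p) ^ m * 1 := by
          gcongr; exact Real.abs_iteratedDeriv_cos_le_one _ _
      _ = _ := mul_one _
  have := (DerivBound.sum _ hterm).const_mul (1 / (p : ℝ))
  simp only [Finset.sum_const, Finset.card_range, nsmul_eq_mul, mul_one] at this
  rwa [abs_of_pos (by positivity), one_div_mul_cancel hp'.ne'] at this

lemma cosKernel_add_int (x : ℝ) (m : ℤ) : cosKernel p (x + m) = cosKernel p x := by
  unfold cosKernel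
  congr 1
  refine Finset.sum_congr rfl fun l _ => ?_
  rw [show 2 * Real.pi * l * (x + m) = 2 * Real.pi * l * x + ((l * m : ℤ) : ℝ) * (2 * Real.pi) by
    push_cast; ring, Real.cos_add_int_mul_two_pi]

lemma cosKernel_zero (hp : 0 < p) : cosKernel p 0 = 1 := by
  have hp' : (p : ℝ) ≠ 0 := by exact_mod_cast hp.ne'
  simp [cosKernel, hp']

lemma cosKernel_int (hp : 0 < p) (m : ℤ) : cosKernel p m = 1 := by
  rw [← zero_add (m : ℝ), cosKernel_add_int, cosKernel_zero hp]

/-- The integers being critical points, a selected kick exerts no force through the middle angles.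
-/
lemma hasDerivAt_cosKernel_int (m : ℤ) : HasDerivAt (cosKernel p) 0 m := by
  have : ∀ l ∈ Finset.range p,
      HasDerivAt (fun x : ℝ => Real.cos (2 * Real.pi * l * x)) 0 (m : ℝ) := by
    intro l _
    have h := ((hasDerivAt_id' (m : ℝ)).const_mul (2 * Real.pi * l)).cos
    convert h using 1
    rw [show 2 * Real.pi * l * (m : ℝ) = ((2 * l * m : ℤ) : ℝ) * Real.pi by push_cast; ring,
      Real.sin_int_mul_pi]
    simp
  have h := (HasDerivAt.fun_sum this).const_mul (1 / (p : ℝ))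
  simp only [Finset.sum_const_zero, mul_zero] at h
  exact h

/-- The sum is the real part of a geometric sum over a nontrivial `p`-th root of unity. -/
lemma cosKernel_div (hp : 0 < p) {k : ℤ} (hk : ¬ (p : ℤ) ∣ k) : cosKernel p (k / p) = 0 := by
  have hp' : (p : ℂ) ≠ 0 := by exact_mod_cast hp.ne'
  set ζ : ℂ := Complex.exp (2 * Real.pi * Complex.I * (k / p)) with hζ
  have h1 : ζ ≠ 1 := by
    intro h
    obtain ⟨n, hn⟩ := Complex.exp_eq_one_iff.1 h
    have h2 : (2 * Real.pi * Complex.I : ℂ) ≠ 0 := Complex.two_pi_I_ne_zero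
    rw [mul_comm (n : ℂ)] at hn
    have h3 := mul_left_cancel₀ h2 hn
    rw [div_eq_iff hp'] at h3
    exact hk ⟨n, by rw [mul_comm]; exact_mod_cast h3⟩
  have h2 : ζ ^ p = 1 := by
    rw [hζ, ← Complex.exp_nat_mul, Complex.exp_eq_one_iff]
    exact ⟨k, by field_simp⟩
  have h3 : ∑ l ∈ Finset.range p, ζ ^ l = 0 := by
    have := mul_geom_sum ζ p
    rw [h2, sub_self] at this
    exact (mul_eq_zero.1 this).resolve_left (sub_ne_zero.2 h1)
  have h4 : ∀ l : ℕ, (ζ ^ l).re = Real.cos (2 * Real.pi * l * (k / p)) := by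
    intro l
    rw [hζ, ← Complex.exp_nat_mul,
      show (l : ℂ) * (2 * Real.pi * Complex.I * (k / p)) =
        ((2 * Real.pi * l * (k / p) : ℝ) : ℂ) * Complex.I by push_cast; ring,
      Complex.exp_ofReal_mul_I_re]
  unfold cosKernel
  simp_rw [← h4]
  rw [← Complex.re_sum, h3, Complex.zero_re, mul_zero]

end Kernel

/-- If all the kernels `D_p` are non-zero at `k/p, …, k/p^d` then `p^d` divides `k`. -/
lemma pow_dvd_of_cosKernel_ne_zero {p : ℕ} (hp : 0 < p) {k : ℤ} (d : ℕ)
    (h : ∀ i < d, cosKernel p (k / (p : ℝ) ^ (i + 1)) ≠ 0) : (p : ℤ) ^ d ∣ k := by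
  have hp' : (p : ℝ) ≠ 0 := by exact_mod_cast hp.ne'
  induction d with
  | zero => simp
  | succ d ih =>
    obtain ⟨k', rfl⟩ := ih fun i hi => h i (hi.trans (Nat.lt_succ_self d))
    have h1 := h d (Nat.lt_succ_self d)
    have e : (((p : ℤ) ^ d * k' : ℤ) : ℝ) / (p : ℝ) ^ (d + 1) = (k' : ℝ) / p := by
      push_cast; rw [pow_succ]; field_simp
    rw [e] at h1
    have : (p : ℤ) ∣ k' := by
      by_contra hk
      exact h1 (cosKernel_div hp hk)
    rw [pow_succ]
    exact mul_dvd_mul_left _ this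

/-! ### Rotating pendulum orbits with a prescribed period. -/

section Pendulum

variable {U : ℝ → ℝ}

/-- The reciprocal of the velocity of a pendulum with potential `ρ U`, in units in which the
velocity is `1` where `U` vanishes. -/
noncomputable def slowness (U : ℝ → ℝ) (ρ x : ℝ) : ℝ := (√(1 - ρ * U x))⁻¹

lemma one_sub_mul_pos (h1 : ∀ x, U x ≤ 1) {ρ : ℝ} (hρ0 : 0 ≤ ρ) (hρ1 : ρ < 1) (x : ℝ) :
    0 < 1 - ρ * U x := by
  nlinarith [h1 x]

lemma continuous_slowness (hU : Continuous U) (h1 : ∀ x, U x ≤ 1) {ρ : ℝ} (hρ0 : 0 ≤ ρ)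
    (hρ1 : ρ < 1) : Continuous (slowness U ρ) := by
  unfold slowness
  exact Continuous.inv₀ (by fun_prop)
    fun x => (Real.sqrt_pos.2 (one_sub_mul_pos h1 hρ0 hρ1 x)).ne'

lemma one_le_slowness (h0 : ∀ x, 0 ≤ U x) (h1 : ∀ x, U x ≤ 1) {ρ : ℝ} (hρ0 : 0 ≤ ρ)
    (hρ1 : ρ < 1) (x : ℝ) : 1 ≤ slowness U ρ x := by
  have := one_sub_mul_pos h1 hρ0 hρ1 x
  refine (one_le_inv₀ (Real.sqrt_pos.2 this)).2 (Real.sqrt_le_one.2 ?_)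
  nlinarith [mul_nonneg hρ0 (h0 x)]

/-- By the intermediate value theorem every period at least `1` is attained. -/
lemma exists_period (hU : Continuous U) (h0 : ∀ x, 0 ≤ U x) (h1 : ∀ x, U x ≤ 1)
    (htop : ∀ x, |x - 1 / 2| ≤ 1 / 16 → U x = 1) {m : ℝ} (hm : 1 ≤ m) :
    ∃ ρ : ℝ, 0 ≤ ρ ∧ ρ < 1 ∧ ∫ x in (0 : ℝ)..1, slowness U ρ x = m := by
  -- For this value the slowness is `8m` on the plateau `U = 1`, of length at least `1/8`, so
  -- crossing the plateau alone contributes `m`.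
  set ρ₁ : ℝ := 1 - (1 / (8 * m)) ^ 2 with hρ₁
  have hm8 : 0 < 1 / (8 * m) := by positivity
  have hm8' : 1 / (8 * m) ≤ 1 := by rw [div_le_one (by positivity)]; linarith
  have hρ0 : 0 ≤ ρ₁ := by nlinarith
  have hρ1 : ρ₁ < 1 := by nlinarith
  -- Clamping `ρ` to `[0, ρ₁]` keeps the integrand continuous for every real `ρ`.
  set P : ℝ → ℝ := fun ρ => ∫ x in (0 : ℝ)..1, slowness U (max 0 (min ρ ρ₁)) x with hP
  have hPc : Continuous P := by
    refine intervalIntegral.continuous_parametric_intervalIntegral_of_continuous' ?_ 0 1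
    unfold slowness Function.uncurry
    refine Continuous.inv₀ (by fun_prop) fun x => ?_
    exact (Real.sqrt_pos.2 (one_sub_mul_pos h1 (le_max_left _ _)
      (max_lt one_pos ((min_le_right _ _).trans_lt hρ1)) _)).ne'
  have hP0 : P 0 ≤ m := by
    simp only [hP, min_eq_left hρ0, max_self, slowness]
    simpa using hm
  have hP1 : m ≤ P ρ₁ := by
    simp only [hP, min_self, max_eq_right hρ0]
    have hi : ∀ a b, IntervalIntegrable (slowness U ρ₁) MeasureTheory.volume a b := fun a b =>
      (continuous_slowness hU h1 hρ0 hρ1).intervalIntegrable a b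
    have hsub : ∫ x in (7 / 16 : ℝ)..(9 / 16), slowness U ρ₁ x ≤
        ∫ x in (0 : ℝ)..1, slowness U ρ₁ x := by
      refine intervalIntegral.integral_mono_interval (by norm_num) (by norm_num) (by norm_num) ?_
        (hi _ _)
      exact MeasureTheory.ae_of_all _ fun x =>
        zero_le_one.trans (one_le_slowness h0 h1 hρ0 hρ1 x)
    refine le_trans (le_of_eq ?_) hsub
    rw [intervalIntegral.integral_congr (g := fun _ => 8 * m)]
    · rw [intervalIntegral.integral_const, smul_eq_mul]; ring
    · intro x hx
      rw [Set.uIcc_of_le (by norm_num)] at hx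
      have hUx : U x = 1 := htop x (by rw [abs_le]; constructor <;> linarith [hx.1, hx.2])
      simp only [slowness, hUx, hρ₁]
      rw [show 1 - (1 - (1 / (8 * m)) ^ 2) * 1 = (1 / (8 * m)) ^ 2 by ring,
        Real.sqrt_sq hm8.le, one_div, inv_inv]
  obtain ⟨ρ, hρ, hPρ⟩ := intermediate_value_Icc hρ0 hPc.continuousOn ⟨hP0, hP1⟩
  refine ⟨ρ, hρ.1, hρ.2.trans_lt hρ1, ?_⟩
  simpa only [hP, min_eq_left hρ.2, max_eq_right hρ.1] using hPρ

/-- A rotating orbit of the pendulum of period `N m`, moving with velocity `1 / N` where the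
potential vanishes. -/
theorem exists_pendulum_orbit (hU : Continuous U) (h0 : ∀ x, 0 ≤ U x) (h1 : ∀ x, U x ≤ 1)
    (hper : ∀ x, U (x + 1) = U x) (hbot : ∀ x, |x| ≤ 3 / 8 → U x = 0)
    (htop : ∀ x, |x - 1 / 2| ≤ 1 / 16 → U x = 1) {N m : ℝ} (hN : 0 < N) (hm : 1 ≤ m) :
    ∃ (ρ : ℝ) (Θ : ℝ → ℝ), 0 ≤ ρ ∧ ρ < 1 ∧
      (∀ t, HasDerivAt Θ (N⁻¹ * √(1 - ρ * U (Θ t))) t) ∧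
      (∀ t (k : ℤ), Θ (t + k * (N * m)) = Θ t + k) ∧
      (∀ t, |t| ≤ 3 / 8 * N → Θ t = t / N) ∧
      ∀ t, |Θ t| ≤ 3 / 8 → t = N * Θ t := by
  obtain ⟨ρ, hρ0, hρ1, hρm⟩ := exists_period hU h0 h1 htop hm
  have hc := continuous_slowness hU h1 hρ0 hρ1
  have hi : ∀ a b, IntervalIntegrable (slowness U ρ) MeasureTheory.volume a b := fun a b =>
    hc.intervalIntegrable a b
  have hge := one_le_slowness h0 h1 hρ0 hρ1
  -- `T` is the time needed to reach the angle `θ`; the orbit is its inverse, and the properties of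
  -- `Θ` are read off from `T`.
  set T : ℝ → ℝ := fun θ => N * ∫ x in (0 : ℝ)..θ, slowness U ρ x with hT
  have hTd : ∀ θ, HasDerivAt T (N * slowness U ρ θ) θ := fun θ =>
    (intervalIntegral.integral_hasDerivAt_right (hi _ _) (hc.stronglyMeasurableAtFilter _ _)
      hc.continuousAt).const_mul N
  have hTc : Continuous T := continuous_iff_continuousAt.2 fun θ => (hTd θ).continuousAt
  have hTmono : StrictMono T := strictMono_of_deriv_pos fun θ => by
    rw [(hTd θ).deriv]
    exact mul_pos hN (one_pos.trans_le (hge θ))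
  have hTpos : ∀ θ, 0 ≤ θ → N * θ ≤ T θ := fun θ hθ => by
    have := intervalIntegral.integral_mono_on hθ (f := fun _ => (1 : ℝ)) (by simp) (hi 0 θ)
      fun x _ => hge x
    simp only [intervalIntegral.integral_const, sub_zero, smul_eq_mul, mul_one] at this
    exact mul_le_mul_of_nonneg_left this hN.le
  have hTneg : ∀ θ, θ ≤ 0 → T θ ≤ N * θ := fun θ hθ => by
    have := intervalIntegral.integral_mono_on hθ (f := fun _ => (1 : ℝ)) (by simp) (hi θ 0)
      fun x _ => hge x
    simp only [intervalIntegral.integral_const, smul_eq_mul, mul_one, zero_sub] at this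
    refine mul_le_mul_of_nonneg_left ?_ hN.le
    rw [intervalIntegral.integral_symm]
    linarith
  have hTsurj : Function.Surjective T := by
    refine hTc.surjective ?_ ?_
    · exact tendsto_atTop_mono' _ ((eventually_ge_atTop 0).mono hTpos)
        (tendsto_id.const_mul_atTop hN)
    · exact tendsto_atBot_mono' _ ((eventually_le_atBot 0).mono hTneg)
        (tendsto_id.const_mul_atBot hN)
  have hgper : Function.Periodic (slowness U ρ) 1 := fun x => by simp only [slowness, hper]
  have hTper : ∀ θ (k : ℤ), T (θ + k) = T θ + k * (N * m) := by
    have step : ∀ θ, T (θ + 1) = T θ + N * m := fun θ => by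
      simp only [hT]
      rw [← intervalIntegral.integral_add_adjacent_intervals (hi 0 θ) (hi θ (θ + 1)),
        hgper.intervalIntegral_add_eq θ 0, zero_add, hρm]
      ring
    intro θ k
    induction k using Int.induction_on with
    | zero => simp
    | succ k ih =>
      push_cast at ih ⊢
      rw [← add_assoc, step, ih]; ring
    | pred k ih =>
      push_cast at ih ⊢
      have := step (θ + (-k - 1))
      rw [show θ + (-(k : ℝ) - 1) + 1 = θ + -k by ring, ih] at this
      linarith
  have hTlin : ∀ θ, |θ| ≤ 3 / 8 → T θ = N * θ := fun θ hθ => by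
    simp only [hT]
    rw [intervalIntegral.integral_congr (g := fun _ => (1 : ℝ))]
    · simp
    · intro x hx
      have hx' : |x| ≤ 3 / 8 := by
        have := Set.abs_sub_left_of_mem_uIcc hx
        rw [sub_zero, sub_zero] at this
        exact this.trans hθ
      simp [slowness, hbot x hx']
  set e := hTmono.orderIsoOfSurjective T hTsurj with he
  have hTΘ : ∀ t, T (e.symm t) = t := fun t => e.apply_symm_apply t
  have hΘT : ∀ θ, e.symm (T θ) = θ := fun θ => e.symm_apply_apply θ
  refine ⟨ρ, e.symm, hρ0, hρ1, fun t => ?_, fun t k => ?_, fun t ht => ?_, fun t ht => ?_⟩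
  · have := (hTd (e.symm t)).of_local_left_inverse e.symm.continuous.continuousAt
      (mul_pos hN (one_pos.trans_le (hge _))).ne' (Eventually.of_forall hTΘ)
    simpa [slowness, mul_comm] using this
  · apply hTmono.injective
    rw [hTΘ, hTper, hTΘ]
  · apply hTmono.injective
    rw [hTΘ, hTlin, mul_div_cancel₀ _ hN.ne']
    rw [abs_div, abs_of_pos hN, div_le_iff₀ hN]
    exact ht
  · rw [← hTlin _ ht, hTΘ]

end Pendulum

lemma distInt_neg (x : ℝ) : distInt (-x) = distInt x := by
  have key : ∀ y, distInt (-y) ≤ distInt y := fun y => by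
    refine (distInt_le_abs_sub (-y) (-round y)).trans_eq ?_
    unfold distInt
    push_cast
    rw [← abs_neg]; congr 1; ring
  exact le_antisymm (key x) (by simpa using key (-x))

lemma distInt_sub_int (x : ℝ) (m : ℤ) : distInt (x - m) = distInt x := by
  unfold distInt
  rw [round_sub_intCast]; push_cast; congr 1; ring

lemma continuous_distInt : Continuous distInt :=
  continuous_of_abs_sub_le (L := 1) fun x y => by simpa using abs_distInt_sub_le x y

/-! ### The train of kicks and its primitives. -/

section Kick

/-- The train of kicks `β²` repeated with period `q`. -/
noncomputable def kickTrain (β : ℝ → ℝ) (q t : ℝ) : ℝ := β (q * distInt (t / q)) ^ 2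

variable {β : ℝ → ℝ} {q : ℝ}

lemma kickTrain_add_period (hq : 1 ≤ q) (t : ℝ) : kickTrain β q (t + q) = kickTrain β q t := by
  unfold kickTrain
  rw [add_div, div_self (by linarith), distInt_add_one]

lemma kickTrain_neg (t : ℝ) : kickTrain β q (-t) = kickTrain β q t := by
  unfold kickTrain
  rw [neg_div, distInt_neg]

/-- The bound `7/8` instead of `1/2` makes the intervals around consecutive multiples of `q`
overlap, so that the train is differentiable everywhere; the neighbouring bumps have half-width `1/8
≤ q/8`. -/
lemma kickTrain_eq (hq : 1 ≤ q) (heven : ∀ x, β (-x) = β x) (hβ0 : ∀ x, 1 / 8 ≤ |x| → β x = 0)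
    {t : ℝ} {m : ℤ} (h : |t - m * q| < 7 / 8 * q) : kickTrain β q t = β (t - m * q) ^ 2 := by
  have hq0 : 0 < q := by linarith
  have e : t - m * q = q * (t / q - m) := by field_simp
  rw [e, abs_mul, abs_of_pos hq0, mul_comm, mul_lt_mul_iff_left₀ hq0] at h
  unfold kickTrain
  rw [e, ← distInt_sub_int (t / q) m]
  set y := t / q - m
  rcases le_or_gt |y| (1 / 2) with hy | hy
  · rw [distInt_eq_abs hy]
    rcases abs_choice y with h' | h' <;> rw [h']
    rw [mul_neg, heven]
  · rw [hβ0, hβ0]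
    · rw [abs_mul, abs_of_pos hq0]; nlinarith
    · have h2 : 1 / 8 ≤ distInt y := by
        rcases le_or_gt 0 y with hy0 | hy0
        · rw [abs_of_nonneg hy0] at h hy
          rw [← distInt_sub_int y 1, distInt_eq_abs]
          · rw [abs_of_nonpos (by push_cast; linarith)]; push_cast; linarith
          · rw [abs_of_nonpos (by push_cast; linarith)]; push_cast; linarith
        · rw [abs_of_neg hy0] at h hy
          rw [← distInt_sub_int y (-1), distInt_eq_abs]
          · rw [abs_of_nonneg (by push_cast; linarith)]; push_cast; linarith
          · rw [abs_of_nonneg (by push_cast; linarith)]; push_cast; linarith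
      rw [abs_of_nonneg (by positivity)]; nlinarith

lemma continuous_kickTrain (hβ : Continuous β) : Continuous (kickTrain β q) := by
  have := continuous_distInt
  unfold kickTrain
  fun_prop

/-- The momentum transferred up to time `t`. -/
noncomputable def kickSum (β : ℝ → ℝ) (q t : ℝ) : ℝ := ∫ s in (0 : ℝ)..t, kickTrain β q s

lemma hasDerivAt_kickSum (hβ : Continuous β) (t : ℝ) :
    HasDerivAt (kickSum β q) (kickTrain β q t) t :=
  have hc := continuous_kickTrain (q := q) hβ
  intervalIntegral.integral_hasDerivAt_right (hc.intervalIntegrable _ _)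
    (hc.stronglyMeasurableAtFilter _ _) hc.continuousAt

lemma continuous_kickSum (hβ : Continuous β) : Continuous (kickSum β q) :=
  continuous_iff_continuousAt.2 fun t => (hasDerivAt_kickSum hβ t).continuousAt

lemma kickSum_zero : kickSum β q 0 = 0 := by simp [kickSum]

lemma kickSum_mono (hβ : Continuous β) : Monotone (kickSum β q) :=
  monotone_of_deriv_nonneg (fun t => (hasDerivAt_kickSum hβ t).differentiableAt) fun t => by
    rw [(hasDerivAt_kickSum hβ t).deriv]; exact sq_nonneg _

lemma kickSum_add_period (hβ : Continuous β) (hq : 1 ≤ q) (t : ℝ) :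
    kickSum β q (t + q) = kickSum β q t + kickSum β q q := by
  have hc := continuous_kickTrain (q := q) hβ
  have hper : Function.Periodic (kickTrain β q) q := kickTrain_add_period hq
  unfold kickSum
  rw [← intervalIntegral.integral_add_adjacent_intervals (hc.intervalIntegrable 0 t)
    (hc.intervalIntegrable t (t + q)), hper.intervalIntegral_add_eq t 0, zero_add]

lemma kickSum_neg (t : ℝ) : kickSum β q (-t) = -kickSum β q t := by
  unfold kickSum
  have := intervalIntegral.integral_comp_neg (a := 0) (b := t) (kickTrain β q)
  simp only [kickTrain_neg, neg_zero] at this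
  rw [this, intervalIntegral.integral_symm]

lemma kickSum_nat_mul (hβ : Continuous β) (hq : 1 ≤ q) (m : ℕ) :
    kickSum β q (m * q) = m * kickSum β q q := by
  induction m with
  | zero => simp [kickSum_zero]
  | succ m ih =>
    push_cast
    rw [add_mul, one_mul, kickSum_add_period hβ hq, ih]; ring

lemma kickSum_period_ge (hβ : Continuous β) (hq : 1 ≤ q) (heven : ∀ x, β (-x) = β x)
    (hβ0 : ∀ x, 1 / 8 ≤ |x| → β x = 0) (hβ1 : ∀ x, |x| ≤ 1 / 16 → β x = 1) :
    1 / 16 ≤ kickSum β q q := by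
  have h1 : kickSum β q (1 / 16) = 1 / 16 := by
    unfold kickSum
    rw [intervalIntegral.integral_congr (g := fun _ => (1 : ℝ))]
    · simp
    · intro x hx
      rw [Set.uIcc_of_le (by norm_num)] at hx
      have habs : |x| ≤ 1 / 16 := by rw [abs_of_nonneg hx.1]; exact hx.2
      simp only
      rw [kickTrain_eq (m := 0) hq heven hβ0 (by simp only [Int.cast_zero, zero_mul, sub_zero]; linarith)]
      simp [hβ1 x habs]
  rw [← h1]
  exact kickSum_mono hβ (by linarith)

/-- The second primitive of the train of kicks. -/
noncomputable def kickSum₂ (β : ℝ → ℝ) (q t : ℝ) : ℝ := ∫ s in (0 : ℝ)..t, kickSum β q s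

lemma hasDerivAt_kickSum₂ (hβ : Continuous β) (t : ℝ) :
    HasDerivAt (kickSum₂ β q) (kickSum β q t) t :=
  have hc := continuous_kickSum (q := q) hβ
  intervalIntegral.integral_hasDerivAt_right (hc.intervalIntegrable _ _)
    (hc.stronglyMeasurableAtFilter _ _) hc.continuousAt

/-- The train is even and periodic, so the transferred momentum is antisymmetric about the middle of
the period up to a constant, and its mean is half of its total. -/
lemma kickSum₂_period (hβ : Continuous β) (hq : 1 ≤ q) :
    kickSum₂ β q q = q * kickSum β q q / 2 := by
  have hc := continuous_kickSum (q := q) hβ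
  have h1 := intervalIntegral.integral_comp_sub_left (a := 0) (b := q) (kickSum β q) q
  simp only [sub_self, sub_zero] at h1
  have h2 : ∀ t, kickSum β q (q - t) = kickSum β q q - kickSum β q t := fun t => by
    rw [show q - t = -t + q by ring, kickSum_add_period hβ hq, kickSum_neg]; ring
  simp_rw [h2] at h1
  rw [intervalIntegral.integral_sub (by simp) (hc.intervalIntegrable _ _)] at h1
  simp only [intervalIntegral.integral_const, sub_zero, smul_eq_mul] at h1
  unfold kickSum₂
  linarith

lemma kickSum₂_add_period (hβ : Continuous β) (hq : 1 ≤ q) (t : ℝ) :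
    kickSum₂ β q (t + q) = kickSum₂ β q q + kickSum₂ β q t + kickSum β q q * t := by
  have hc := continuous_kickSum (q := q) hβ
  unfold kickSum₂
  rw [add_comm t q, ← intervalIntegral.integral_add_adjacent_intervals (hc.intervalIntegrable 0 q)
    (hc.intervalIntegrable q (q + t))]
  have h1 := intervalIntegral.integral_comp_add_right (a := 0) (b := t) (kickSum β q) q
  simp_rw [kickSum_add_period hβ hq] at h1
  rw [intervalIntegral.integral_add (hc.intervalIntegrable _ _) (by simp), zero_add,
    add_comm t q] at h1
  simp only [intervalIntegral.integral_const, sub_zero, smul_eq_mul] at h1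
  rw [← h1]; ring

/-- The exact quadratic growth makes the drifting angle an integer at each kick, once `δ` is
normalised. -/
lemma kickSum₂_nat_mul (hβ : Continuous β) (hq : 1 ≤ q) (m : ℕ) :
    kickSum₂ β q (m * q) = q * m ^ 2 * kickSum β q q / 2 := by
  induction m with
  | zero => simp [kickSum₂]
  | succ m ih =>
    push_cast
    rw [add_mul, one_mul, kickSum₂_add_period hβ hq, ih, kickSum₂_period hβ hq]; ring

end Kick

/-! ### Periodic functions as functions on the torus. -/

section TorusFunction

variable {n : ℕ}

/-- The function on `𝕋ⁿ × ℝⁿ` defined by a function of the angles. -/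
noncomputable def ofAngles (F : (Fin n → ℝ) → ℝ) : Torus n → (Fin n → ℝ) → ℝ :=
  fun ϑ _ => F fun i => Function.surjInv QuotientAddGroup.mk_surjective (ϑ i)

lemma lift_ofAngles {F : (Fin n → ℝ) → ℝ}
    (hF : ∀ (x : Fin n → ℝ) (k : Fin n → ℤ), F (fun i => x i + k i) = F x) :
    lift (ofAngles F) = fun p => F p.1 := by
  funext p
  have h : ∀ i, ∃ k : ℤ, (Function.surjInv QuotientAddGroup.mk_surjective (toTorus p.1 i) : ℝ) =
      p.1 i + k := by
    intro i
    have h1 := Function.surjInv_eq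
      (QuotientAddGroup.mk_surjective (s := AddSubgroup.zmultiples (1 : ℝ))) (toTorus p.1 i)
    have h2 : ((Function.surjInv QuotientAddGroup.mk_surjective (toTorus p.1 i) - p.1 i : ℝ) :
        UnitAddCircle) = 0 := by
      rw [AddCircle.coe_sub, sub_eq_zero]; exact h1
    obtain ⟨k, hk⟩ := (AddCircle.coe_eq_zero_iff (1 : ℝ)).1 h2
    refine ⟨k, ?_⟩
    rw [zsmul_eq_mul, mul_one] at hk
    rw [hk]; ring
  choose k hk using h
  simp only [lift, ofAngles]
  simp_rw [hk]
  exact hF p.1 k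

end TorusFunction

/-! ### The perturbation: periodicity, size and differential. -/

section Potential

variable {e : ℕ}

/-- The index of the `j`-th of the `n - 2` angles other than the first and the last one. -/
def midIdx (j : Fin (e + 1)) : Fin (e + 1 + 2) := j.succ.castSucc

/-- The index of the angle of the pendulum. -/
def pendIdx (e : ℕ) : Fin (e + 1 + 2) := midIdx (Fin.last e)

/-- The index of the angle that plays the role of time. -/
def lastIdx (e : ℕ) : Fin (e + 1 + 2) := Fin.last (e + 1 + 1)

lemma midIdx_ne_zero (j : Fin (e + 1)) : midIdx j ≠ 0 := fun h => by
  have := congrArg Fin.val h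
  simp [midIdx] at this

lemma zero_ne_lastIdx : (0 : Fin (e + 1 + 2)) ≠ lastIdx e := (Fin.last_pos).ne

lemma midIdx_ne_last (j : Fin (e + 1)) : midIdx j ≠ lastIdx e := Fin.castSucc_ne_last _

lemma midIdx_injective : Function.Injective (midIdx (e := e)) := fun a b h => by
  simpa [midIdx] using h

lemma eq_zero_or_midIdx_or_last (i : Fin (e + 1 + 2)) :
    i = 0 ∨ (∃ j, i = midIdx j) ∨ i = lastIdx e := by
  refine Fin.lastCases (Or.inr (Or.inr rfl)) (fun i => ?_) i
  refine Fin.cases (Or.inl rfl) (fun j => Or.inr (Or.inl ⟨j, rfl⟩)) i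

variable (β b w : ℝ → ℝ) (p : ℕ) (lam δ : ℝ)

/-- The product of kernels that selects one passage of the angles `x_1, …, x_{n-2}`. -/
noncomputable def selector (x : Fin (e + 1 + 2) → ℝ) : ℝ :=
  ∏ j : Fin (e + 1), cosKernel p (x (midIdx j) - x (lastIdx e) / (p : ℝ) ^ (j.val + 1))

/-- The square root of the strength of the kick. -/
noncomputable def kickAmp (x : Fin (e + 1 + 2) → ℝ) : ℝ :=
  b (x (pendIdx e)) * β (x (lastIdx e)) * selector p x

/-- The perturbation near the section where the last angle vanishes. -/
noncomputable def localPotential (x : Fin (e + 1 + 2) → ℝ) : ℝ :=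
  lam * b (x (pendIdx e) + 1 / 2) + -δ * (w (x 0) * (kickAmp β b p x * kickAmp β b p x))

/-- Translation of the last angle by `-c`. -/
noncomputable def shiftLast (c : ℝ) (x : Fin (e + 1 + 2) → ℝ) : Fin (e + 1 + 2) → ℝ :=
  x - Pi.single (lastIdx e) c

/-- Translation of the last angle into `[-1/2, 1/2]`. -/
noncomputable def wrapLast (x : Fin (e + 1 + 2) → ℝ) : Fin (e + 1 + 2) → ℝ :=
  shiftLast (round (x (lastIdx e))) x

/-- The perturbation as a periodic function on `ℝⁿ`. -/
noncomputable def potential (x : Fin (e + 1 + 2) → ℝ) : ℝ :=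
  localPotential β b w p lam δ (wrapLast x)

variable {β b w p lam δ}

lemma shiftLast_mid (x : Fin (e + 1 + 2) → ℝ) (c : ℝ) (j : Fin (e + 1)) :
    shiftLast c x (midIdx j) = x (midIdx j) := by
  simp [shiftLast, midIdx_ne_last j]

lemma shiftLast_zero (x : Fin (e + 1 + 2) → ℝ) (c : ℝ) : shiftLast c x 0 = x 0 := by
  simp [shiftLast, zero_ne_lastIdx]

lemma shiftLast_last (x : Fin (e + 1 + 2) → ℝ) (c : ℝ) :
    shiftLast c x (lastIdx e) = x (lastIdx e) - c := by
  simp [shiftLast]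

/-- The selector involves `x_{n-1} / p^(j+1)` and is not periodic in the last angle; wrapping that
angle repairs this, and the kernels handle integer shifts of the middle ones. -/
lemma potential_add_int (hb : ∀ x, b (x + 1) = b x) (hw : ∀ x, w (x + 1) = w x)
    (x : Fin (e + 1 + 2) → ℝ) (k : Fin (e + 1 + 2) → ℤ) :
    potential β b w p lam δ (fun i => x i + k i) = potential β b w p lam δ x := by
  have hb' : ∀ y (m : ℤ), b (y + m) = b y := fun y m => by
    simpa using (show Function.Periodic b 1 from hb).int_mul m y
  have hw' : ∀ y (m : ℤ), w (y + m) = w y := fun y m => by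
    simpa using (show Function.Periodic w 1 from hw).int_mul m y
  have hlast : wrapLast (fun i => x i + k i) (lastIdx e) = wrapLast x (lastIdx e) := by
    unfold wrapLast
    rw [shiftLast_last, shiftLast_last, round_add_intCast]
    push_cast; ring
  have hmid : ∀ j, wrapLast (fun i => x i + k i) (midIdx j) = wrapLast x (midIdx j) +
      k (midIdx j) := fun j => by
    unfold wrapLast; rw [shiftLast_mid, shiftLast_mid]
  have hzero : wrapLast (fun i => x i + k i) 0 = wrapLast x 0 + k 0 := by
    unfold wrapLast; rw [shiftLast_zero, shiftLast_zero]
  have hsel : selector p (wrapLast fun i => x i + k i) = selector p (wrapLast x) := by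
    unfold selector
    refine Finset.prod_congr rfl fun j _ => ?_
    rw [hlast, hmid, add_sub_right_comm, cosKernel_add_int]
  unfold potential localPotential kickAmp pendIdx
  rw [hsel, hlast, hmid, hzero, hb', hw', add_right_comm, hb']

/-- The nearest integer jumps only where `β` vanishes, and there just the pendulum term is left;
hence the wrapping preserves smoothness. -/
lemma potential_eventuallyEq (hβ0 : ∀ x, 1 / 8 ≤ |x| → β x = 0) (x : Fin (e + 1 + 2) → ℝ) :
    potential β b w p lam δ =ᶠ[𝓝 x] fun y => localPotential β b w p lam δ
      (shiftLast (round (x (lastIdx e))) y) := by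
  set m := round (x (lastIdx e))
  have hopen : ∀ᶠ y : Fin (e + 1 + 2) → ℝ in 𝓝 x, |y (lastIdx e) - m| < 7 / 8 := by
    have hc : Continuous fun y : Fin (e + 1 + 2) → ℝ => |y (lastIdx e) - m| :=
      ((continuous_apply _).sub continuous_const).abs
    refine hc.continuousAt.eventually_lt continuousAt_const ?_
    exact (abs_sub_round _).trans_lt (by norm_num)
  filter_upwards [hopen] with y hy
  unfold potential wrapLast
  by_cases h : round (y (lastIdx e)) = m
  · rw [h]
  · have h1 : (1 : ℝ) ≤ |(round (y (lastIdx e)) : ℝ) - m| := by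
      exact_mod_cast Int.one_le_abs (sub_ne_zero.2 h)
    have h2 := abs_sub_round (y (lastIdx e))
    have h3 : |(round (y (lastIdx e)) : ℝ) - m| ≤
        |y (lastIdx e) - round (y (lastIdx e))| + |y (lastIdx e) - m| := by
      rw [abs_sub_comm (y _) (round (y (lastIdx e)) : ℝ)]; exact abs_sub_le _ _ _
    have e1 : β (y (lastIdx e) - round (y (lastIdx e))) = 0 := hβ0 _ (by linarith)
    have e2 : β (y (lastIdx e) - m) = 0 := hβ0 _ (by linarith)
    unfold localPotential kickAmp
    simp only [pendIdx, shiftLast_mid, shiftLast_last, e1, e2]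
    simp

section Bounds

variable {M : ℕ → ℝ} {Bβ Bb Bw σ : ℝ}

lemma norm_proj_le {n : ℕ} (i : Fin n) :
    ‖(ContinuousLinearMap.proj i : (Fin n → ℝ) →L[ℝ] ℝ)‖ ≤ 1 :=
  ContinuousLinearMap.opNorm_le_bound _ zero_le_one fun x => by
    simpa using norm_le_pi_norm x i

/-- The coefficients `p^(-(j+1))` are at most `1`, so the frequencies remain of order `p` although
passages are separated modulo `p^(n-2)`. This is why `S` is evaluated at a multiple of `p`. -/
lemma derivBound_selector (hp : 0 < p) :
    DerivBound Set.univ (fun _ => 1) (selector (e := e) p) 1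
      ((e + 1 : ℕ) * (2 * (2 * Real.pi * p))) := by
  have hp1 : (1 : ℝ) ≤ p := by exact_mod_cast hp
  have := DerivBound.prod (S := Set.univ) (Finset.univ : Finset (Fin (e + 1)))
    (F := fun j (x : Fin (e + 1 + 2) → ℝ) => cosKernel p (x (midIdx j) - x (lastIdx e) / (p : ℝ) ^ (j.val + 1)))
    (σ := 2 * (2 * Real.pi * p)) (by positivity) fun j _ => by
      have hpj : (1 : ℝ) ≤ (p : ℝ) ^ (j.val + 1) := one_le_pow₀ hp1
      have hL : ‖(ContinuousLinearMap.proj (midIdx j) : (Fin (e + 1 + 2) → ℝ) →L[ℝ] ℝ) -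
          ((p : ℝ) ^ (j.val + 1))⁻¹ • ContinuousLinearMap.proj (lastIdx e)‖ ≤ 2 := by
        refine (norm_sub_le _ _).trans ?_
        rw [norm_smul, Real.norm_eq_abs, abs_of_pos (by positivity)]
        have h1 := norm_proj_le (midIdx j)
        have h2 := norm_proj_le (lastIdx e)
        have h3 : ((p : ℝ) ^ (j.val + 1))⁻¹ ≤ 1 := inv_le_one_of_one_le₀ hpj
        have h4 : ((p : ℝ) ^ (j.val + 1))⁻¹ *
            ‖(ContinuousLinearMap.proj (lastIdx e) : (Fin (e + 1 + 2) → ℝ) →L[ℝ] ℝ)‖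
              ≤ 1 := mul_le_one₀ h3 (norm_nonneg _) h2
        linarith
      have := (derivBound_cosKernel hp).comp_linear (S := Set.univ) (fun _ => zero_le_one)
        zero_le_one (by positivity) _ hL
      convert this using 2 with x
      simp [div_eq_inv_mul]
  rw [Finset.card_univ, Fintype.card_fin] at this
  exact this

/-- The scale `6σ` counts the factors: one for `w`, four for `(b β)²`, one for the squared selector,
which alone produces the large constant. -/
theorem derivBound_localPotential (hM : IsWeight M) (h1 : CondH1 M) (hσ : 0 < σ) (hp : 0 < p)
    (hBβ : 0 ≤ Bβ) (hBb : 0 ≤ Bb) (hBw : 0 ≤ Bw)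
    (hβ : ContDiff ℝ ∞ β) (hβB : ∀ k x, |iteratedDeriv k β x| ≤ Bβ * σ ^ k * M k)
    (hb : ContDiff ℝ ∞ b) (hbB : ∀ k x, |iteratedDeriv k b x| ≤ Bb * σ ^ k * M k)
    (hw : ContDiff ℝ ∞ w) (hwB : ∀ k x, |iteratedDeriv k w x| ≤ Bw * σ ^ k * M k) :
    DerivBound Set.univ M (localPotential (e := e) β b w p lam δ)
      (|lam| * Bb + |δ| * (Bw * ((Bb * Bβ) ^ 2 *
        weightSup M (8 * Real.pi * (e + 1 : ℕ) / σ * p)))) (6 * σ) := by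
  have hM0 : ∀ m, 0 ≤ M m := fun m => (hM.1 m).le
  have hmul := hM.mul_le h1
  have hsel := derivBound_selector (e := e) hp
  have hsel2 := (hsel.mul hsel (fun _ => zero_le_one) (fun _ _ => by simp) zero_le_one zero_le_one
    (by positivity) (by positivity))
  rw [mul_one] at hsel2
  have hselM := hsel2.of_one hM h1 (by positivity) hσ
  rw [show (((e + 1 : ℕ) : ℝ) * (2 * (2 * Real.pi * p)) + (e + 1 : ℕ) * (2 * (2 * Real.pi * p))) / σ
    = 8 * Real.pi * (e + 1 : ℕ) / σ * p by ring] at hselM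
  set Ssup := weightSup M (8 * Real.pi * (e + 1 : ℕ) / σ * p)
  have hS0 : 0 ≤ Ssup := zero_le_one.trans (hM.one_le_weightSup h1 (by positivity))
  have hbL := (DerivBound.of_iteratedDeriv hb hbB).comp_linear (S := Set.univ) hM0 hBb hσ.le
    _ (norm_proj_le (pendIdx e))
  have hβL := (DerivBound.of_iteratedDeriv hβ hβB).comp_linear (S := Set.univ) hM0 hBβ hσ.le
    _ (norm_proj_le (lastIdx e))
  have hwL := (DerivBound.of_iteratedDeriv hw hwB).comp_linear (S := Set.univ) hM0 hBw hσ.le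
    _ (norm_proj_le (0 : Fin (e + 1 + 2)))
  have hUL : DerivBound Set.univ M (fun x : Fin (e + 1 + 2) → ℝ => b (x (pendIdx e) + 1 / 2)) Bb
      (6 * σ) :=
    ((DerivBound.of_iteratedDeriv (f := fun x => b (x + 1 / 2))
      (hb.comp (contDiff_id.add contDiff_const)) fun k x => by
        rw [iteratedDeriv_comp_add_const]; exact hbB k _).comp_linear (S := Set.univ) hM0 hBb hσ.le
      _ (norm_proj_le (pendIdx e))).mono hM0 (by linarith) hBb le_rfl (by linarith)
  rw [one_mul] at hbL hβL hwL
  have hbβ := hbL.mul hβL hM0 hmul hBb hBβ hσ.le hσ.le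
  have hbβ2 := hbβ.mul hbβ hM0 hmul (by positivity) (by positivity) (by positivity) (by positivity)
  have hall := hwL.mul (hbβ2.mul hselM hM0 hmul (by positivity) hS0 (by positivity) hσ.le)
    hM0 hmul hBw (by positivity) hσ.le (by positivity)
  rw [show σ + (σ + σ + (σ + σ) + σ) = 6 * σ by ring] at hall
  have := (hUL.const_mul lam).add (hall.const_mul (-δ))
  rw [abs_neg] at this
  convert this using 1
  · funext x
    unfold localPotential kickAmp
    simp only [ContinuousLinearMap.proj_apply]
    ring
  · ring

end Bounds

section Gradient

/-- The differential of the coordinate `x_i`. -/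
noncomputable def coordForm {n : ℕ} (i : Fin n) : (Fin n → ℝ) →L[ℝ] ℝ := ContinuousLinearMap.proj i

lemma hasFDerivAt_coord {n : ℕ} (i : Fin n) (x : Fin n → ℝ) :
    HasFDerivAt (fun y : Fin n → ℝ => y i) (coordForm i) x :=
  (ContinuousLinearMap.proj i : (Fin n → ℝ) →L[ℝ] ℝ).hasFDerivAt

lemma differentiable_kickAmp (hp : 0 < p) (hβ : ContDiff ℝ ∞ β) (hb : ContDiff ℝ ∞ b) :
    Differentiable ℝ (kickAmp (e := e) β b p) := by
  have h1 : Differentiable ℝ (selector (e := e) p) :=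
    (derivBound_selector hp).smooth.differentiable (by simp)
  have h2 := hβ.differentiable (by simp)
  have h3 := hb.differentiable (by simp)
  unfold kickAmp
  fun_prop

/-- The kick enters through a square, so its differential vanishes wherever the amplitude does,
whatever the differential `A` of the amplitude. -/
lemma hasFDerivAt_potential (hβ0 : ∀ x, 1 / 8 ≤ |x| → β x = 0)
    (hb : ContDiff ℝ ∞ b) (hw : ContDiff ℝ ∞ w) {x : Fin (e + 1 + 2) → ℝ}
    {A : (Fin (e + 1 + 2) → ℝ) →L[ℝ] ℝ}
    (hA : HasFDerivAt (kickAmp β b p) A (wrapLast x)) :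
    HasFDerivAt (potential β b w p lam δ)
      (lam • deriv b (x (pendIdx e) + 1 / 2) • coordForm (pendIdx e) -
        δ • ((kickAmp β b p (wrapLast x) ^ 2 * deriv w (x 0)) • coordForm 0 +
          (2 * w (x 0) * kickAmp β b p (wrapLast x)) • A)) x := by
  refine HasFDerivAt.congr_of_eventuallyEq ?_ (potential_eventuallyEq hβ0 x)
  have hz : wrapLast x 0 = x 0 := shiftLast_zero _ _
  have hpd : wrapLast x (pendIdx e) = x (pendIdx e) := shiftLast_mid _ _ _
  have hwd : HasFDerivAt (fun y : Fin (e + 1 + 2) → ℝ => w (y 0)) (deriv w (x 0) • coordForm 0)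
      (wrapLast x) := by
    have h1 : HasDerivAt w (deriv w (x 0)) (wrapLast x 0) := by
      rw [hz]; exact (hw.differentiable (by simp) _).hasDerivAt
    exact h1.comp_hasFDerivAt (wrapLast x) (hasFDerivAt_coord 0 _)
  have hbd : HasFDerivAt (fun y : Fin (e + 1 + 2) → ℝ => b (y (pendIdx e) + 1 / 2))
      (deriv b (x (pendIdx e) + 1 / 2) • coordForm (pendIdx e)) (wrapLast x) := by
    have h1 : HasDerivAt b (deriv b (x (pendIdx e) + 1 / 2)) (wrapLast x (pendIdx e) + 1 / 2) := by
      rw [hpd]; exact (hb.differentiable (by simp) _).hasDerivAt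
    exact h1.comp_hasFDerivAt (wrapLast x) ((hasFDerivAt_coord (pendIdx e) _).add_const _)
  have h0 : HasFDerivAt (localPotential β b w p lam δ)
      (lam • deriv b (x (pendIdx e) + 1 / 2) • coordForm (pendIdx e) -
        δ • ((kickAmp β b p (wrapLast x) ^ 2 * deriv w (x 0)) • coordForm 0 +
          (2 * w (x 0) * kickAmp β b p (wrapLast x)) • A)) (wrapLast x) := by
    have h := (hbd.const_mul lam).add ((hwd.mul (hA.mul hA)).const_mul (-δ))
    refine h.congr_fderiv ?_
    ext v
    simp [hz]
    ring
  have hs : HasFDerivAt (shiftLast (round (x (lastIdx e)) : ℝ))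
      (ContinuousLinearMap.id ℝ (Fin (e + 1 + 2) → ℝ)) x :=
    HasFDerivAt.sub_const (f := fun y => y)
      (Pi.single (lastIdx e) (round (x (lastIdx e)) : ℝ) : Fin (e + 1 + 2) → ℝ) (hasFDerivAt_id x)
  exact (HasFDerivAt.comp x (f := shiftLast (round (x (lastIdx e)))) h0 hs)

/-- On a selected passage `b` is at its maximum and each kernel is at a critical point, so only `β`
contributes to the differential. -/
lemma hasFDerivAt_kickAmp_on (hp : 0 < p) (hβ : ContDiff ℝ ∞ β) (hb : ContDiff ℝ ∞ b)
    (hb1 : ∀ x, b x ≤ 1) {y : Fin (e + 1 + 2) → ℝ} (hy : b (y (pendIdx e)) = 1)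
    (hint : ∀ j : Fin (e + 1), ∃ m : ℤ,
      y (midIdx j) - y (lastIdx e) / (p : ℝ) ^ (j.val + 1) = m) :
    kickAmp β b p y = β (y (lastIdx e)) ∧
      HasFDerivAt (kickAmp β b p) (deriv β (y (lastIdx e)) • coordForm (lastIdx e)) y := by
  have hb' : HasFDerivAt (fun y : Fin (e + 1 + 2) → ℝ => b (y (pendIdx e)))
      (0 : (Fin (e + 1 + 2) → ℝ) →L[ℝ] ℝ) y := by
    have hmax : IsLocalMax b (y (pendIdx e)) := Eventually.of_forall fun z => by
      rw [hy]; exact hb1 z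
    have h1 : HasDerivAt b 0 (y (pendIdx e)) := by
      rw [← hmax.deriv_eq_zero]; exact (hb.differentiable (by simp) _).hasDerivAt
    have h2 := h1.comp_hasFDerivAt y (hasFDerivAt_coord (pendIdx e) y)
    rw [zero_smul] at h2
    exact h2
  have hβ' : HasFDerivAt (fun y : Fin (e + 1 + 2) → ℝ => β (y (lastIdx e)))
      (deriv β (y (lastIdx e)) • coordForm (lastIdx e)) y :=
    (hβ.differentiable (by simp) _).hasDerivAt.comp_hasFDerivAt y (hasFDerivAt_coord _ _)
  have hone : ∀ j : Fin (e + 1),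
      cosKernel p (y (midIdx j) - y (lastIdx e) / (p : ℝ) ^ (j.val + 1)) = 1 := fun j => by
    obtain ⟨m, hm⟩ := hint j
    rw [hm, cosKernel_int hp]
  have hsel : selector p y = 1 := Finset.prod_eq_one fun j _ => hone j
  have hsel' : HasFDerivAt (selector (e := e) p) (0 : (Fin (e + 1 + 2) → ℝ) →L[ℝ] ℝ) y := by
    have h := HasFDerivAt.finsetProd (u := Finset.univ) (x := y)
      (g := fun (j : Fin (e + 1)) (x : Fin (e + 1 + 2) → ℝ) =>
        cosKernel p (x (midIdx j) - x (lastIdx e) / (p : ℝ) ^ (j.val + 1)))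
      (g' := fun _ => 0) fun j _ => by
        obtain ⟨m, hm⟩ := hint j
        have h1 := hasDerivAt_cosKernel_int (p := p) m
        rw [← hm] at h1
        have h2 := h1.comp_hasFDerivAt y ((hasFDerivAt_coord (midIdx j) y).sub
          ((hasFDerivAt_coord (lastIdx e) y).mul_const (((p : ℝ) ^ (j.val + 1))⁻¹)))
        rw [zero_smul] at h2
        exact h2
    refine h.congr_fderiv ?_
    simp
  refine ⟨by simp [kickAmp, hy, hsel], ?_⟩
  refine ((hb'.mul hβ').mul hsel').congr_fderiv ?_
  ext v
  simp [hy, hsel]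

end Gradient

end Potential

section KickDerivative

variable {β : ℝ → ℝ} {q : ℝ}

lemma hasDerivAt_kickTrain (hq : 1 ≤ q) (hβ : ContDiff ℝ ∞ β) (heven : ∀ x, β (-x) = β x)
    (hβ0 : ∀ x, 1 / 8 ≤ |x| → β x = 0) {t : ℝ} {m : ℤ} (h : |t - m * q| < 7 / 8 * q) :
    HasDerivAt (kickTrain β q) (2 * β (t - m * q) * deriv β (t - m * q)) t := by
  have h1 : HasDerivAt (fun s => β (s - m * q)) (deriv β (t - m * q)) t :=
    ((hβ.differentiable (by simp) _).hasDerivAt).comp_sub_const t (m * q)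
  have h2 : HasDerivAt (fun s => β (s - m * q) ^ 2)
      (2 * β (t - m * q) * deriv β (t - m * q)) t := by
    simpa using h1.fun_pow 2
  refine h2.congr_of_eventuallyEq ?_
  have hopen : ∀ᶠ s in 𝓝 t, |s - m * q| < 7 / 8 * q :=
    ContinuousAt.eventually_lt (by fun_prop) continuousAt_const h
  filter_upwards [hopen] with s hs
  exact kickTrain_eq hq heven hβ0 hs

lemma abs_sub_round_div_mul (hq : 0 < q) (t : ℝ) : |t - round (t / q) * q| ≤ q / 2 := by
  have h := abs_sub_round (t / q)
  have e : t - round (t / q) * q = (t / q - round (t / q)) * q := by field_simp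
  rw [e, abs_mul, abs_of_pos hq]
  nlinarith

end KickDerivative

/-! ### The force of the perturbation along the orbit. -/

section OrbitGradient

variable {e : ℕ} {β b w : ℝ → ℝ} {p m : ℕ} {lam δ : ℝ} {Θ : ℝ → ℝ}

/-- Away from the kicks the selector vanishes: it singles out the passages at the times `k q`. -/
lemma exists_round_eq_of_kickAmp_ne_zero (hp : 0 < p)
    (hb0 : ∀ x, 1 / 8 ≤ distInt x → b x = 0)
    (hΘper : ∀ t (k : ℤ), Θ (t + k * ((p : ℝ) ^ (e + 1) * m)) = Θ t + k)
    (hΘlin : ∀ t, |Θ t| ≤ 3 / 8 → t = (p : ℝ) ^ (e + 1) * Θ t)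
    {t : ℝ} {x : Fin (e + 1 + 2) → ℝ} (hlast : x (lastIdx e) = t)
    (hmid : ∀ j, j ≠ Fin.last e → x (midIdx j) = t / (p : ℝ) ^ (j.val + 1))
    (hpend : x (pendIdx e) = Θ t) (hne : kickAmp β b p (wrapLast x) ≠ 0) :
    ∃ k : ℤ, round t = k * ((p : ℤ) ^ (e + 1) * m) := by
  have hp0 : (0 : ℝ) < p := by exact_mod_cast hp
  have hp1 : (1 : ℝ) ≤ p := by exact_mod_cast hp
  set N : ℝ := (p : ℝ) ^ (e + 1) with hN
  have hN0 : 0 < N := by positivity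
  have hN1 : 1 ≤ N := one_le_pow₀ hp1
  have hwl : wrapLast x (lastIdx e) = t - round t := by
    unfold wrapLast; rw [shiftLast_last, hlast]
  have hwm : ∀ j, wrapLast x (midIdx j) = x (midIdx j) := fun j => by
    unfold wrapLast; rw [shiftLast_mid]
  have hbne : b (Θ t) ≠ 0 := by
    intro h0
    apply hne
    unfold kickAmp pendIdx
    rw [hwm]
    change b (x (pendIdx e)) * _ * _ = 0
    rw [hpend, h0]; ring
  have hdist : distInt (Θ t) < 1 / 8 := by
    by_contra hcon
    exact hbne (hb0 _ (not_lt.1 hcon))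
  set k := round (Θ t) with hk
  have hs : Θ (t + (-k : ℤ) * (N * m)) = Θ t - k := by
    rw [hΘper]; push_cast; ring
  have hΘk : |Θ t - k| < 1 / 8 := hdist
  -- Going back `k` periods brings the pendulum into its linear region, so `t - kq = N (Θ t - k)`.
  have ht := hΘlin (t + (-k : ℤ) * (N * m)) (by rw [hs]; linarith)
  rw [hs] at ht
  push_cast at ht
  refine ⟨k, ?_⟩
  set K := round t with hK
  set k' : ℤ := K - k * ((p : ℤ) ^ (e + 1) * m) with hk'
  have hk'r : (k' : ℝ) = K - k * (N * m) := by rw [hk', hN]; push_cast; ring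
  have hsel : selector p (wrapLast x) ≠ 0 := by
    intro h0; apply hne; unfold kickAmp; rw [h0, mul_zero]
  -- Modulo integers the argument of each kernel is `k' / p^(i+1)`, the fractional part of `t`
  -- cancelling out; the pendulum angle supplies the last power of `p`.
  have hker : ∀ i < e + 1, cosKernel p (k' / (p : ℝ) ^ (i + 1)) ≠ 0 := by
    intro i hi
    have h1 := Finset.prod_ne_zero_iff.1 hsel ⟨i, hi⟩ (Finset.mem_univ _)
    rw [hwm, hwl] at h1
    by_cases hie : (⟨i, hi⟩ : Fin (e + 1)) = Fin.last e
    · have hie' : i = e := congrArg Fin.val hie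
      rw [hie] at h1
      change cosKernel p (x (pendIdx e) - _) ≠ 0 at h1
      rw [hpend] at h1
      have e1 : Θ t - (t - K) / (p : ℝ) ^ ((Fin.last e).val + 1) = k' / (p : ℝ) ^ (i + 1) + k := by
        rw [Fin.val_last, hie', ← hN, hk'r]
        field_simp
        linarith
      rwa [e1, cosKernel_add_int] at h1
    · rw [hmid _ hie] at h1
      have e1 : t / (p : ℝ) ^ (i + 1) - (t - K) / (p : ℝ) ^ (i + 1) =
          k' / (p : ℝ) ^ (i + 1) + ((k * ((p : ℤ) ^ (e - i) * m) : ℤ) : ℝ) := by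
        have : N = (p : ℝ) ^ (i + 1) * (p : ℝ) ^ (e - i) := by
          rw [hN, ← pow_add]; congr 1; omega
        rw [hk'r, this]
        push_cast
        field_simp
        ring
      change cosKernel p (t / (p : ℝ) ^ (i + 1) - (t - K) / (p : ℝ) ^ (i + 1)) ≠ 0 at h1
      rwa [e1, cosKernel_add_int] at h1
  have hdvd := pow_dvd_of_cosKernel_ne_zero hp (e + 1) hker
  -- The kernels leave only multiples of `N`; the bump `b`, which gives `|t - kq| ≤ N/8`, excludes
  -- the nonzero ones.
  have habs : |k'| < (p : ℤ) ^ (e + 1) := by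
    have h1 : |(k' : ℝ)| < N := by
      have h2 := abs_sub_round t
      rw [abs_le] at h2
      have h3 : |N * (Θ t - k)| ≤ N * (1 / 8) := by
        rw [abs_mul, abs_of_pos hN0]; gcongr
      rw [← ht, abs_le] at h3
      rw [abs_lt, hk'r]
      constructor <;> linarith [h2.1, h2.2, h3.1, h3.2]
    rw [hN] at h1
    exact_mod_cast h1
  have := Int.eq_zero_of_abs_lt_dvd hdvd habs
  linarith

/-- The differential of the perturbation along the orbit. -/
theorem hasFDerivAt_potential_orbit (hp : 8 ≤ p) (hm : 1 ≤ m)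
    (hβ : ContDiff ℝ ∞ β) (heven : ∀ x, β (-x) = β x) (hβ0 : ∀ x, 1 / 8 ≤ |x| → β x = 0)
    (hb : ContDiff ℝ ∞ b) (hb1 : ∀ x, b x ≤ 1) (hbtop : ∀ x, distInt x ≤ 1 / 16 → b x = 1)
    (hb0 : ∀ x, 1 / 8 ≤ distInt x → b x = 0) (hw : ContDiff ℝ ∞ w)
    (hΘper : ∀ t (k : ℤ), Θ (t + k * ((p : ℝ) ^ (e + 1) * m)) = Θ t + k)
    (hΘzero : ∀ t, |t| ≤ 3 / 8 * (p : ℝ) ^ (e + 1) → Θ t = t / (p : ℝ) ^ (e + 1))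
    (hΘlin : ∀ t, |Θ t| ≤ 3 / 8 → t = (p : ℝ) ^ (e + 1) * Θ t)
    {t : ℝ} {x : Fin (e + 1 + 2) → ℝ} (hlast : x (lastIdx e) = t)
    (hmid : ∀ j, j ≠ Fin.last e → x (midIdx j) = t / (p : ℝ) ^ (j.val + 1))
    (hpend : x (pendIdx e) = Θ t) :
    HasFDerivAt (potential β b w p lam δ)
      (lam • deriv b (Θ t + 1 / 2) • coordForm (pendIdx e) -
        δ • ((kickTrain β ((p : ℝ) ^ (e + 1) * m) t * deriv w (x 0)) • coordForm 0 +
          (w (x 0) * deriv (kickTrain β ((p : ℝ) ^ (e + 1) * m)) t) • coordForm (lastIdx e))) x := by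
  have hp0 : 0 < p := by omega
  have hp0' : (0 : ℝ) < p := by exact_mod_cast hp0
  have hp8 : (8 : ℝ) ≤ p := by exact_mod_cast hp
  have hm1 : (1 : ℝ) ≤ m := by exact_mod_cast hm
  set N : ℝ := (p : ℝ) ^ (e + 1) with hN
  have hN8 : 8 ≤ N := hp8.trans (le_self_pow₀ (by linarith) (by omega))
  set q : ℝ := N * m with hq
  have hq8 : 8 ≤ q := by nlinarith
  have hwl : wrapLast x (lastIdx e) = t - round t := by
    unfold wrapLast; rw [shiftLast_last, hlast]
  have hwm : ∀ j, wrapLast x (midIdx j) = x (midIdx j) := fun j => by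
    unfold wrapLast; rw [shiftLast_mid]
  have hround := abs_sub_round t
  -- Either the current passage is a selected one, where every kernel is at an integer, or the
  -- amplitude of the kick is zero.
  by_cases hcase : ∃ k : ℤ, round t = k * ((p : ℤ) ^ (e + 1) * m)
  · obtain ⟨k, hk⟩ := hcase
    have hkr : (round t : ℝ) = k * q := by rw [hk, hq, hN]; push_cast; ring
    rw [hkr] at hround
    have hlt : |t - k * q| < 7 / 8 * q := by linarith
    have hΘt : Θ t = (t - k * q) / N + k := by
      have := hΘper (t - k * q) k
      rw [sub_add_cancel] at this
      rw [this, hΘzero _ (by linarith)]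
    obtain ⟨h1, h2⟩ := hasFDerivAt_kickAmp_on (β := β) (b := b) (y := wrapLast x) hp0 hβ hb hb1
      (by
        unfold pendIdx
        rw [hwm]
        change b (x (pendIdx e)) = 1
        rw [hpend, hΘt]
        refine hbtop _ ((distInt_le_abs_sub _ k).trans ?_)
        rw [add_sub_cancel_right, abs_div, abs_of_pos (show 0 < N by linarith),
          div_le_iff₀ (show 0 < N by linarith)]
        linarith)
      (fun j => by
        rw [hwm, hwl, hkr]
        by_cases hje : j = Fin.last e
        · refine ⟨k, ?_⟩
          rw [hje]
          change x (pendIdx e) - _ = _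
          rw [hpend, hΘt, Fin.val_last, ← hN]; ring
        · refine ⟨k * ((p : ℤ) ^ (e - j.val) * m), ?_⟩
          have hjlt : j.val < e := Fin.val_lt_last hje
          have : N = (p : ℝ) ^ (j.val + 1) * (p : ℝ) ^ (e - j.val) := by
            rw [hN, ← pow_add]; congr 1; omega
          rw [hmid j hje, hq, this]
          push_cast
          field_simp
          ring)
    rw [hwl, hkr] at h1 h2
    have hG := hasFDerivAt_potential (lam := lam) (δ := δ) hβ0 hb hw h2
    refine hG.congr_fderiv ?_
    rw [h1, (hasDerivAt_kickTrain (by linarith) hβ heven hβ0 hlt).deriv,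
      kickTrain_eq (by linarith) heven hβ0 hlt, hpend]
    ext v
    simp only [sub_apply, add_apply, smul_apply, smul_eq_mul]
    ring
  · have hamp : kickAmp β b p (wrapLast x) = 0 := by
      by_contra hne
      exact hcase (exists_round_eq_of_kickAmp_ne_zero hp0 hb0 hΘper hΘlin hlast hmid hpend hne)
    have hG := hasFDerivAt_potential (lam := lam) (δ := δ) hβ0 hb hw
      (differentiable_kickAmp hp0 hβ hb (wrapLast x)).hasFDerivAt
    refine hG.congr_fderiv ?_
    -- The train must vanish as well: within `1/8` of a multiple of `q`, the nearest integer to `t`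
    -- would be that multiple, because `1/2 + 1/8 < 1`.
    have hr : β (t - round (t / q) * q) = 0 := by
      refine hβ0 _ (not_lt.1 fun hlt => hcase ⟨round (t / q), ?_⟩)
      have h3 : ((round (t / q) * ((p : ℤ) ^ (e + 1) * m) : ℤ) : ℝ) = round (t / q) * q := by
        rw [hq, hN]; push_cast; ring
      rw [← h3] at hlt
      have h4 : |((round t - round (t / q) * ((p : ℤ) ^ (e + 1) * m) : ℤ) : ℝ)| < 1 := by
        push_cast
        push_cast at hlt
        have := abs_sub_le (round t : ℝ) t (round (t / q) * ((p : ℝ) ^ (e + 1) * m))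
        rw [abs_sub_comm (round t : ℝ) t] at this
        linarith
      have h5 : |round t - round (t / q) * ((p : ℤ) ^ (e + 1) * m)| < 1 := by exact_mod_cast h4
      have := Int.abs_lt_one_iff.1 h5
      linarith
    have hlt : |t - round (t / q) * q| < 7 / 8 * q :=
      (abs_sub_round_div_mul (by linarith) t).trans_lt (by linarith)
    rw [(hasDerivAt_kickTrain (by linarith) hβ heven hβ0 hlt).deriv,
      kickTrain_eq (by linarith) heven hβ0 hlt, hr, hamp, hpend]
    simp

end OrbitGradient

/-! ### The unperturbed Hamiltonian and its quasi-convexity. -/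

section Unperturbed

variable {e : ℕ}

/-- The second derivatives of the unperturbed Hamiltonian. -/
noncomputable def hessCoeff (A : ℝ) (i : Fin (e + 1 + 2)) : ℝ :=
  if i = 0 then 2 else if i = lastIdx e then 0 else A

/-- The unperturbed Hamiltonian `I_0² + (A/2) (I_1² + ⋯ + I_{n-2}²) + I_{n-1}`. -/
noncomputable def unperturbed (A : ℝ) (I : Fin (e + 1 + 2) → ℝ) : ℝ :=
  ∑ i, hessCoeff A i / 2 * (I i * I i) + I (lastIdx e)

lemma hessCoeff_zero (A : ℝ) : hessCoeff A (0 : Fin (e + 1 + 2)) = 2 := by simp [hessCoeff]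

lemma hessCoeff_last (A : ℝ) : hessCoeff A (lastIdx e) = 0 := by
  simp [hessCoeff, zero_ne_lastIdx.symm]

lemma hessCoeff_mid (A : ℝ) (j : Fin (e + 1)) : hessCoeff A (midIdx j) = A := by
  have h : midIdx j ≠ lastIdx e := midIdx_ne_last j
  simp [hessCoeff, midIdx_ne_zero, h]

lemma hasFDerivAt_unperturbed (A : ℝ) (I : Fin (e + 1 + 2) → ℝ) :
    HasFDerivAt (unperturbed A)
      (∑ i, (hessCoeff A i * I i) • coordForm i + coordForm (lastIdx e)) I := by
  have h1 : ∀ i ∈ Finset.univ, HasFDerivAt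
      (fun I : Fin (e + 1 + 2) → ℝ => hessCoeff A i / 2 * (I i * I i))
      ((hessCoeff A i * I i) • coordForm i) I := fun i _ => by
    refine (((hasFDerivAt_coord i I).mul (hasFDerivAt_coord i I)).const_mul
      (hessCoeff A i / 2)).congr_fderiv ?_
    ext v
    simp
    ring
  exact (HasFDerivAt.fun_sum h1).add (hasFDerivAt_coord (lastIdx e) I)

lemma grad_unperturbed (A : ℝ) (I : Fin (e + 1 + 2) → ℝ) (i : Fin (e + 1 + 2)) :
    grad (unperturbed A) I i = hessCoeff A i * I i + if i = lastIdx e then 1 else 0 := by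
  unfold grad
  rw [(hasFDerivAt_unperturbed A I).fderiv]
  simp [coordForm, Pi.single_apply, eq_comm]

lemma iteratedFDeriv_two_unperturbed (A : ℝ) (I ξ : Fin (e + 1 + 2) → ℝ) :
    iteratedFDeriv ℝ 2 (unperturbed A) I ![ξ, ξ] = ∑ i, hessCoeff A i * ξ i ^ 2 := by
  rw [iteratedFDeriv_two_apply]
  have h0 : fderiv ℝ (unperturbed A) = fun I : Fin (e + 1 + 2) → ℝ =>
      ∑ i, (hessCoeff A i * I i) • coordForm i + coordForm (lastIdx e) :=
    funext fun I => (hasFDerivAt_unperturbed A I).fderiv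
  have h1 : ∀ i ∈ Finset.univ, HasFDerivAt
      (fun I : Fin (e + 1 + 2) → ℝ => (hessCoeff A i * I i) • (coordForm i))
      ((hessCoeff A i • coordForm i : (Fin (e + 1 + 2) → ℝ) →L[ℝ] ℝ).smulRight (coordForm i)) I :=
    fun i _ => ((hasFDerivAt_coord i I).const_mul (hessCoeff A i)).smul_const (coordForm i)
  rw [h0, ((HasFDerivAt.fun_sum h1).add_const (coordForm (lastIdx e))).fderiv]
  simp [coordForm]
  refine Finset.sum_congr rfl fun i _ => by ring

/-- The Hessian degenerates only in the last direction, in which the gradient has component `1`. If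
the other components of `ξ` carry a fraction `1/(2(A+1))` of its norm, the Hessian suffices;
otherwise the last term dominates `∇h · ξ`, the others amounting to at most `A` times their norm. -/
theorem isQuasiConvex_unperturbed {A : ℝ} (hA : 2 ≤ A) :
    IsQuasiConvex (n := e + 1 + 2) (1 / 2)
      (2 / ((e + 1 + 2 : ℕ) * (2 * (A + 1)) ^ 2)) (unperturbed A) (ballD (e + 1 + 2)) := by
  have hco : ∀ i : Fin (e + 1 + 2), 0 ≤ hessCoeff A i ∧ hessCoeff A i ≤ A := fun i => by
    unfold hessCoeff; split_ifs <;> constructor <;> linarith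
  have hco2 : ∀ i : Fin (e + 1 + 2), i ≠ lastIdx e → 2 ≤ hessCoeff A i := fun i hi => by
    unfold hessCoeff; rw [if_neg hi]; split_ifs <;> linarith
  intro I hI
  have hI1 : ∀ i, |I i| ≤ 1 := fun i =>
    (Finset.single_le_sum (f := fun i => |I i|) (fun _ _ => abs_nonneg _)
      (Finset.mem_univ i)).trans (le_of_lt hI)
  have hgl : grad (unperturbed A) I (lastIdx e) = 1 := by
    rw [grad_unperturbed, hessCoeff_last]; simp
  refine ⟨?_, fun ξ => ?_⟩
  · have := Finset.single_le_sum (f := fun i => |grad (unperturbed A) I i|)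
      (fun _ _ => abs_nonneg _) (Finset.mem_univ (lastIdx e))
    simp only [hgl, abs_one] at this
    unfold norm1
    linarith
  · set s := Finset.univ.erase (lastIdx e) with hs
    set a := ∑ i ∈ s, |ξ i| with ha
    have ha0 : 0 ≤ a := Finset.sum_nonneg fun _ _ => abs_nonneg _
    have hn : norm1 ξ = a + |ξ (lastIdx e)| := by
      unfold norm1
      rw [← Finset.sum_erase_add _ _ (Finset.mem_univ (lastIdx e))]
    have hA1 : 0 < 2 * (A + 1) := by linarith
    rcases le_or_gt (norm1 ξ) (2 * (A + 1) * a) with h | h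
    · right
      rw [iteratedFDeriv_two_unperturbed]
      refine le_trans ?_ (le_abs_self _)
      have h1 : ∑ i ∈ s, 2 * |ξ i| ^ 2 ≤ ∑ i, hessCoeff A i * ξ i ^ 2 := by
        rw [← Finset.sum_erase_add _ _ (Finset.mem_univ (lastIdx e)), hessCoeff_last, zero_mul,
          add_zero]
        refine Finset.sum_le_sum fun i hi => ?_
        rw [sq_abs]
        have := hco2 i (Finset.ne_of_mem_erase hi)
        gcongr
      have h2 : a ^ 2 ≤ (e + 1 + 2 : ℕ) * ∑ i ∈ s, |ξ i| ^ 2 := by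
        refine sq_sum_le_card_mul_sum_sq.trans ?_
        gcongr
        exact (Finset.card_le_univ s).trans_eq (Fintype.card_fin _)
      rw [← Finset.mul_sum] at h1
      have h3 : norm1 ξ ^ 2 ≤ (2 * (A + 1) * a) ^ 2 := by
        gcongr
        rw [hn]; positivity
      have hn0 : (0 : ℝ) < (e + 1 + 2 : ℕ) := by positivity
      refine le_trans ?_ h1
      rw [div_mul_eq_mul_div, div_le_iff₀ (by positivity)]
      calc 2 * norm1 ξ ^ 2 ≤ 2 * (2 * (A + 1) * a) ^ 2 := by gcongr
        _ = 2 * (2 * (A + 1)) ^ 2 * a ^ 2 := by ring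
        _ ≤ 2 * (2 * (A + 1)) ^ 2 * ((e + 1 + 2 : ℕ) * ∑ i ∈ s, |ξ i| ^ 2) := by gcongr
        _ = _ := by ring
    · left
      have h1 : |∑ i ∈ s, grad (unperturbed A) I i * ξ i| ≤ A * a := by
        rw [ha, Finset.mul_sum]
        refine (Finset.abs_sum_le_sum_abs _ _).trans (Finset.sum_le_sum fun i hi => ?_)
        rw [abs_mul, grad_unperturbed, if_neg (Finset.ne_of_mem_erase hi), add_zero, abs_mul,
          abs_of_nonneg (hco i).1]
        have h2 := (hco i).1
        have h3 := (hco i).2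
        have h4 : hessCoeff A i * |I i| ≤ A * 1 := by
          gcongr
          exact hI1 i
        rw [mul_one] at h4
        gcongr
      have h2 : ∑ i, grad (unperturbed A) I i * ξ i =
          ∑ i ∈ s, grad (unperturbed A) I i * ξ i + ξ (lastIdx e) := by
        rw [← Finset.sum_erase_add _ _ (Finset.mem_univ (lastIdx e)), hgl, one_mul]
      have h3 : |ξ (lastIdx e)| - A * a ≤ |∑ i, grad (unperturbed A) I i * ξ i| := by
        rw [h2]
        have h4 := abs_sub_abs_le_abs_sub (ξ (lastIdx e))
          (-∑ i ∈ s, grad (unperturbed A) I i * ξ i)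
        rw [sub_neg_eq_add, abs_neg, add_comm (ξ (lastIdx e))] at h4
        linarith
      rw [hn] at h ⊢
      nlinarith

lemma derivBound_unperturbed {M : ℕ → ℝ} (hM : IsWeight M) (h1 : CondH1 M) {σ : ℝ} (hσ : 0 < σ)
    (A : ℝ) : ∃ B : ℝ, 0 ≤ B ∧
      DerivBound (Set.univ ×ˢ ballD (e + 1 + 2)) M
        (fun P : (Fin (e + 1 + 2) → ℝ) × (Fin (e + 1 + 2) → ℝ) => unperturbed A P.2) B (2 * σ) := by
  have hM0 : ∀ m, 0 ≤ M m := fun m => (hM.1 m).le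
  set B0 : ℝ := max 1 (1 / σ)
  have hB0 : 0 ≤ B0 := zero_le_one.trans (le_max_left _ _)
  have hlin : ∀ i : Fin (e + 1 + 2), DerivBound (Set.univ ×ˢ ballD (e + 1 + 2)) M
      (fun P : (Fin (e + 1 + 2) → ℝ) × (Fin (e + 1 + 2) → ℝ) => P.2 i) B0 σ := fun i => by
    refine DerivBound.linear hM hσ ((ContinuousLinearMap.proj i).comp
      (ContinuousLinearMap.snd ℝ (Fin (e + 1 + 2) → ℝ) (Fin (e + 1 + 2) → ℝ))) zero_le_one ?_ ?_
    · refine (ContinuousLinearMap.opNorm_comp_le _ _).trans ?_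
      exact mul_le_one₀ (norm_proj_le i) (norm_nonneg _) (ContinuousLinearMap.norm_snd_le _ _ _)
    · intro P hP
      exact (Finset.single_le_sum (f := fun i => |P.2 i|) (fun _ _ => abs_nonneg _)
        (Finset.mem_univ i)).trans (le_of_lt hP.2)
  have hsum := DerivBound.sum (Finset.univ : Finset (Fin (e + 1 + 2))) fun i _ =>
    ((hlin i).mul (hlin i) hM0 (hM.mul_le h1) hB0 hB0 hσ.le hσ.le).const_mul (hessCoeff A i / 2)
  rw [← two_mul] at hsum
  refine ⟨_, ?_, hsum.add ((hlin (lastIdx e)).mono hM0 hσ.le hB0 le_rfl (by linarith))⟩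
  have : 0 ≤ ∑ i : Fin (e + 1 + 2), |hessCoeff A i / 2| * (B0 * B0) :=
    Finset.sum_nonneg fun i _ => by positivity
  linarith

end Unperturbed

/-! ### The explicit drifting orbit. -/

section Orbit

variable {e : ℕ}

lemma forall_idx {P : Fin (e + 1 + 2) → Prop} (h0 : P 0) (hp : P (pendIdx e))
    (hm : ∀ j, j ≠ Fin.last e → P (midIdx j)) (hl : P (lastIdx e)) (i : Fin (e + 1 + 2)) : P i := by
  rcases eq_zero_or_midIdx_or_last i with rfl | ⟨j, rfl⟩ | rfl
  · exact h0
  · by_cases hj : j = Fin.last e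
    · rw [hj]; exact hp
    · exact hm j hj
  · exact hl

lemma sum_idx (f : Fin (e + 1 + 2) → ℝ) :
    ∑ i, f i = f 0 + ∑ j, f (midIdx j) + f (lastIdx e) := by
  rw [Fin.sum_univ_castSucc, Fin.sum_univ_succ]
  rfl

/-- A vector prescribed separately at the first, the middle, the pendulum and the last index. -/
noncomputable def assemble (z : ℝ) (y : ℕ → ℝ) (v u : ℝ) (i : Fin (e + 1 + 2)) : ℝ :=
  if i = 0 then z else if i = lastIdx e then u else if i = pendIdx e then v else y i.val

lemma assemble_zero (z : ℝ) (y : ℕ → ℝ) (v u : ℝ) :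
    assemble z y v u (0 : Fin (e + 1 + 2)) = z := by simp [assemble]

lemma assemble_last (z : ℝ) (y : ℕ → ℝ) (v u : ℝ) : assemble z y v u (lastIdx e) = u := by
  simp [assemble, zero_ne_lastIdx.symm]

lemma assemble_pend (z : ℝ) (y : ℕ → ℝ) (v u : ℝ) : assemble z y v u (pendIdx e) = v := by
  have h1 : pendIdx e ≠ 0 := midIdx_ne_zero _
  have h2 : pendIdx e ≠ lastIdx e := midIdx_ne_last _
  simp [assemble, h1, h2]

lemma assemble_mid (z : ℝ) (y : ℕ → ℝ) (v u : ℝ) {j : Fin (e + 1)} (hj : j ≠ Fin.last e) :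
    assemble z y v u (midIdx j) = y (j.val + 1) := by
  have h2 : midIdx j ≠ lastIdx e := midIdx_ne_last _
  have h3 : midIdx j ≠ pendIdx e := fun h => hj (midIdx_injective h)
  simp only [assemble, midIdx_ne_zero, h2, h3, if_false]
  rfl

lemma coordForm_single_self {n : ℕ} (i : Fin n) : coordForm i (Pi.single i 1) = 1 := by
  simp [coordForm]

lemma coordForm_single_of_ne {n : ℕ} {i j : Fin n} (h : i ≠ j) :
    coordForm i (Pi.single j 1) = 0 := by
  simp [coordForm, h]

lemma hasDerivAt_ramp {w : ℝ → ℝ} (hwper : ∀ x, w (x + 1) = w x)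
    (hw0 : ∀ x, |x| ≤ 3 / 16 → w x = x) {y : ℝ} {k : ℤ} (h : |y - k| ≤ 1 / 8) :
    HasDerivAt w 1 y := by
  have hopen : ∀ᶠ z : ℝ in 𝓝 y, |z - k| < 3 / 16 :=
    ContinuousAt.eventually_lt (by fun_prop) continuousAt_const (h.trans_lt (by norm_num))
  refine ((hasDerivAt_id' y).sub_const (k : ℝ)).congr_of_eventuallyEq ?_
  filter_upwards [hopen] with z hz
  rw [← hw0 _ hz.le]
  simpa using ((show Function.Periodic w 1 from hwper).sub_int_mul_eq k (x := z)).symm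

lemma norm1_assemble_le {z v u c : ℝ} {y : ℕ → ℝ} (hv : |v| ≤ c) (hy : ∀ i, |y i| ≤ c) :
    norm1 (assemble z y v u : Fin (e + 1 + 2) → ℝ) ≤ |z| + (e + 1 : ℕ) * c + |u| := by
  unfold norm1
  rw [sum_idx, assemble_zero, assemble_last]
  gcongr
  have hmid : ∀ j ∈ (Finset.univ : Finset (Fin (e + 1))),
      |(assemble z y v u : Fin (e + 1 + 2) → ℝ) (midIdx j)| ≤ c := by
    intro j _
    by_cases hj : j = Fin.last e
    · rw [hj]
      change |(assemble z y v u : Fin (e + 1 + 2) → ℝ) (pendIdx e)| ≤ _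
      rwa [assemble_pend]
    · rw [assemble_mid _ _ _ _ hj]
      exact hy _
  refine (Finset.sum_le_sum hmid).trans_eq ?_
  rw [Finset.sum_const, Finset.card_univ, Fintype.card_fin, nsmul_eq_mul]

/-- The action that receives one kick in every period `q`. -/
noncomputable def driftAction (β : ℝ → ℝ) (q δ t : ℝ) : ℝ := -(1 / 2) + δ * kickSum β q t

/-- The angle conjugate to the drifting action. -/
noncomputable def driftAngle (β : ℝ → ℝ) (q δ t : ℝ) : ℝ := -t + 2 * δ * kickSum₂ β q t

section Drift

variable {β w : ℝ → ℝ} {q δ : ℝ}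

lemma hasDerivAt_driftAction (hβ : Continuous β) (t : ℝ) :
    HasDerivAt (driftAction β q δ) (δ * kickTrain β q t) t :=
  ((hasDerivAt_kickSum hβ t).const_mul δ).const_add _

lemma hasDerivAt_driftAngle (hβ : Continuous β) (t : ℝ) :
    HasDerivAt (driftAngle β q δ) (2 * driftAction β q δ t) t := by
  have := (hasDerivAt_id' t).neg.add ((hasDerivAt_kickSum₂ (q := q) hβ t).const_mul (2 * δ))
  refine this.congr_deriv ?_
  unfold driftAction; ring

lemma kickSum_sq (hβ : Continuous β) (hq : 1 ≤ q) {k : ℕ} (hk : q = k) :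
    kickSum β q (q ^ 2) = q * kickSum β q q := by
  have := kickSum_nat_mul hβ hq k
  rw [← hk] at this
  rw [sq, this]

lemma abs_driftAction_le (hβ : Continuous β) (hq : 1 ≤ q) {k : ℕ} (hk : q = k) (hδ : 0 ≤ δ)
    (hδq : δ * (q * kickSum β q q) = 1) {t : ℝ} (ht : t ∈ Set.Icc 0 (q ^ 2)) :
    |driftAction β q δ t| ≤ 1 / 2 := by
  have h1 := kickSum_mono (q := q) hβ ht.1
  have h2 := kickSum_mono (q := q) hβ ht.2
  rw [kickSum_zero] at h1
  rw [kickSum_sq hβ hq hk] at h2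
  have h3 : δ * kickSum β q t ≤ 1 := by rw [← hδq]; gcongr
  have h4 : 0 ≤ δ * kickSum β q t := by positivity
  unfold driftAction
  rw [abs_le]
  constructor <;> linarith

/-- During a kick the angle stays in the region where the ramp has slope one. -/
lemma kickTrain_mul_deriv_ramp (hβ : Continuous β) (heven : ∀ x, β (-x) = β x)
    (hβ0 : ∀ x, 1 / 8 ≤ |x| → β x = 0) (hwper : ∀ x, w (x + 1) = w x)
    (hw0 : ∀ x, |x| ≤ 3 / 16 → w x = x) (hq : 1 ≤ q) {K : ℕ} (hK : q = K) (hδ : 0 ≤ δ)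
    (hδq : δ * (q * kickSum β q q) = 1) {t : ℝ} (ht : t ∈ Set.Icc 0 (q ^ 2)) :
    kickTrain β q t * deriv w (driftAngle β q δ t) = kickTrain β q t := by
  have hq0 : 0 < q := by linarith
  by_cases hκt : kickTrain β q t = 0
  · rw [hκt, zero_mul]
  have hr := abs_sub_round_div_mul hq0 t
  have hκt' := kickTrain_eq hq heven hβ0 (hr.trans_lt (by linarith))
  have hlt : |t - round (t / q) * q| < 1 / 8 := by
    by_contra hcon
    apply hκt
    rw [hκt', hβ0 _ (not_lt.1 hcon)]; norm_num
  have hk0 : 0 ≤ round (t / q) := by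
    have h1 := abs_sub_round (t / q)
    have h2 : 0 ≤ t / q := div_nonneg ht.1 hq0.le
    rw [abs_le] at h1
    have h3 : (-1 : ℝ) < round (t / q) := by linarith
    have h4 : (-1 : ℤ) < round (t / q) := by exact_mod_cast h3
    omega
  obtain ⟨k, hk⟩ := Int.eq_ofNat_of_zero_le hk0
  rw [hk] at hlt
  push_cast at hlt
  have hkq : (k : ℝ) ≤ q := by
    have h1 : (k : ℝ) * q < (q + 1) * q := by
      rw [abs_lt] at hlt
      nlinarith [ht.2, hlt.1]
    have h2 : (k : ℝ) < q + 1 := lt_of_mul_lt_mul_right h1 hq0.le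
    rw [hK] at h2 ⊢
    exact_mod_cast Nat.lt_succ_iff.1 (by exact_mod_cast h2)
  have hkmem : (k : ℝ) * q ∈ Set.Icc 0 (q ^ 2) := ⟨by positivity, by nlinarith⟩
  -- By the normalisation `δ q J = 1`, the angle at the `k`-th kick is `k² - kq`, an integer since
  -- `q` is one.
  have hXk : driftAngle β q δ (k * q) = (((k : ℤ) ^ 2 - k * K : ℤ) : ℝ) := by
    unfold driftAngle
    rw [kickSum₂_nat_mul hβ hq]
    push_cast
    rw [show 2 * δ * (q * (k : ℝ) ^ 2 * kickSum β q q / 2) =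
      δ * (q * kickSum β q q) * (k : ℝ) ^ 2 by ring, hδq, hK]
    ring
  -- The angle moves with speed at most `1` and the kick is active only for `|t - kq| < 1/8`, so the
  -- angle stays within `1/8` of this integer.
  have hmv := (convex_Icc (0 : ℝ) (q ^ 2)).norm_image_sub_le_of_norm_hasDerivWithin_le
    (f := driftAngle β q δ) (f' := fun t => 2 * driftAction β q δ t) (C := 1)
    (fun s _ => (hasDerivAt_driftAngle hβ s).hasDerivWithinAt)
    (fun s hs => by
      rw [Real.norm_eq_abs, abs_mul, abs_two]
      linarith [abs_driftAction_le hβ hq hK hδ hδq hs]) hkmem ht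
  rw [Real.norm_eq_abs, Real.norm_eq_abs, hXk, one_mul] at hmv
  rw [(hasDerivAt_ramp hwper hw0 (hmv.trans hlt.le)).deriv, mul_one]

end Drift

section Hamiltonian

variable {A : ℝ} {F : (Fin (e + 1 + 2) → ℝ) → ℝ} {G : (Fin (e + 1 + 2) → ℝ) →L[ℝ] ℝ}
  {x I : Fin (e + 1 + 2) → ℝ}

lemma lift_unperturbed_add
    (hF : ∀ (x : Fin (e + 1 + 2) → ℝ) (k : Fin (e + 1 + 2) → ℤ), F (fun i => x i + k i) = F x) :
    lift (fun ϑ J => unperturbed A J + ofAngles F ϑ J) =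
      fun P : (Fin (e + 1 + 2) → ℝ) × (Fin (e + 1 + 2) → ℝ) => unperturbed A P.2 + F P.1 := by
  funext P
  have h := congrFun (lift_ofAngles hF) P
  simp only [lift] at h ⊢
  rw [h]

lemma fderiv_lift_unperturbed_add
    (hF : ∀ (x : Fin (e + 1 + 2) → ℝ) (k : Fin (e + 1 + 2) → ℤ), F (fun i => x i + k i) = F x)
    (hG : HasFDerivAt F G x) (i : Fin (e + 1 + 2)) :
    fderiv ℝ (lift (fun ϑ J => unperturbed A J + ofAngles F ϑ J)) (x, I) (dirAction i) =
        hessCoeff A i * I i + (if i = lastIdx e then 1 else 0) ∧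
      fderiv ℝ (lift (fun ϑ J => unperturbed A J + ofAngles F ϑ J)) (x, I) (dirTheta i) =
        G (Pi.single i 1) := by
  have hH := ((hasFDerivAt_unperturbed A I).comp (x, I)
    (hasFDerivAt_snd (𝕜 := ℝ) (p := (x, I)))).add
    (hG.comp (x, I) (hasFDerivAt_fst (𝕜 := ℝ) (p := (x, I))))
  rw [lift_unperturbed_add hF]
  change fderiv ℝ (unperturbed A ∘ Prod.snd + F ∘ Prod.fst) (x, I) _ = _ ∧
    fderiv ℝ (unperturbed A ∘ Prod.snd + F ∘ Prod.fst) (x, I) _ = _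
  rw [hH.fderiv]
  constructor
  · have := grad_unperturbed A I i
    unfold grad at this
    rw [(hasFDerivAt_unperturbed A I).fderiv] at this
    rw [← this]
    simp [dirAction]
  · simp [dirTheta]

end Hamiltonian

set_option maxHeartbeats 1000000 in
/-- The fundamental drifting orbit: over the time `q²`, `q = p^{n-2} m`, the first action changes
by one. -/
theorem exists_drifting_orbit {β b w : ℝ → ℝ} {p m : ℕ} {A : ℝ} (hA : 8 * (e + 1 : ℕ) ≤ A)
    (hp : 256 ≤ p) (hm : 1 ≤ m)
    (hβ : ContDiff ℝ ∞ β) (hβpos : ∀ x, 0 ≤ β x) (hβle : ∀ x, β x ≤ 1)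
    (heven : ∀ x, β (-x) = β x) (hβ1 : ∀ x, |x| ≤ 1 / 16 → β x = 1)
    (hβ0 : ∀ x, 1 / 8 ≤ |x| → β x = 0)
    (hb : ContDiff ℝ ∞ b) (hbpos : ∀ x, 0 ≤ b x) (hb1 : ∀ x, b x ≤ 1)
    (hbper : ∀ x, b (x + 1) = b x) (hbtop : ∀ x, distInt x ≤ 1 / 16 → b x = 1)
    (hb0 : ∀ x, 1 / 8 ≤ distInt x → b x = 0)
    (hw : ContDiff ℝ ∞ w) (hwle : ∀ x, |w x| ≤ 1) (hwper : ∀ x, w (x + 1) = w x)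
    (hw0 : ∀ x, |x| ≤ 3 / 16 → w x = x) :
    ∃ lam δ : ℝ, 0 ≤ lam ∧ lam ≤ 1 / (2 * A * ((p : ℝ) ^ (e + 1)) ^ 2) ∧
      0 ≤ δ ∧ δ ≤ 16 / ((p : ℝ) ^ (e + 1) * m) ∧
      ∃ (θ : ℝ → Torus (e + 1 + 2)) (I : ℝ → Fin (e + 1 + 2) → ℝ),
        IsSolution (fun ϑ J => unperturbed A J + ofAngles (potential β b w p lam δ) ϑ J)
          (((p : ℝ) ^ (e + 1) * m) ^ 2) θ I ∧
        1 ≤ norm1 (I (((p : ℝ) ^ (e + 1) * m) ^ 2) - I 0) := by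
  have hp256 : (256 : ℝ) ≤ p := by exact_mod_cast hp
  have hm1 : (1 : ℝ) ≤ m := by exact_mod_cast hm
  have he1 : (1 : ℝ) ≤ (e + 1 : ℕ) := by exact_mod_cast Nat.succ_le_succ (Nat.zero_le e)
  have hA0 : 0 < A := by linarith
  set N : ℝ := (p : ℝ) ^ (e + 1) with hN
  have hN256 : 256 ≤ N := hp256.trans (le_self_pow₀ (by linarith) (by omega))
  have hN0 : 0 < N := by linarith
  set q : ℝ := N * m with hq
  have hq256 : 256 ≤ q := by nlinarith
  have hq1 : 1 ≤ q := by linarith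
  have hq0 : 0 < q := by linarith
  have hqnat : q = ((p ^ (e + 1) * m : ℕ) : ℝ) := by rw [hq, hN]; push_cast; ring
  obtain ⟨ρ, Θ, hρ0, hρ1, hΘd, hΘper, hΘzero, hΘlin⟩ :=
    exists_pendulum_orbit (U := fun x => b (x + 1 / 2)) (hb.continuous.comp (by fun_prop))
      (fun x => hbpos _) (fun x => hb1 _)
      (fun x => by rw [add_right_comm, hbper])
      (fun x hx => hb0 _ (by
        have h1 := distInt_le_add (1 / 2) (x + 1 / 2)
        rw [distInt_eq_abs (by norm_num), show (1 / 2 : ℝ) - (x + 1 / 2) = -x by ring,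
          abs_neg] at h1
        norm_num at h1 ⊢
        linarith))
      (fun x hx => hbtop _ (by
        refine (distInt_le_abs_sub _ 1).trans ?_
        rw [show x + 1 / 2 - ((1 : ℤ) : ℝ) = x - 1 / 2 by push_cast; ring]
        exact hx)) hN0 hm1
  have hβc := hβ.continuous
  set J := kickSum β q q with hJ
  have hJ16 : 1 / 16 ≤ J := kickSum_period_ge hβc hq1 heven hβ0 hβ1
  have hJ0 : 0 < J := by linarith
  -- Each period transfers `δ J = 1/q` to the first action, so that `q` periods transfer exactly
  -- `1`.
  set δ : ℝ := 1 / (q * J) with hδ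
  have hδ0 : 0 < δ := by positivity
  have hδq : δ * (q * J) = 1 := by rw [hδ]; field_simp
  have hδle : δ ≤ 16 / q := by
    rw [hδ, div_le_div_iff₀ (by positivity) hq0]; nlinarith
  have hδ16 : δ ≤ 1 / 16 := hδle.trans (by rw [div_le_div_iff₀ hq0 (by norm_num)]; linarith)
  -- With this value the pendulum energy `A I²/2 + λ b` is `1/(2AN²)` for the action `I = V/(AN)`,
  -- which gives the velocity `V/N` of `Θ`.
  set lam : ℝ := ρ / (2 * A * N ^ 2) with hlam
  refine ⟨lam, δ, by positivity, by rw [hlam]; gcongr, hδ0.le, hδle, ?_⟩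
  -- the explicit orbit
  set a : ℝ → ℝ := driftAction β q δ with ha
  set X : ℝ → ℝ := driftAngle β q δ with hX
  set V : ℝ → ℝ := fun t => √(1 - ρ * b (Θ t + 1 / 2)) with hV
  set κ : ℝ → ℝ := kickTrain β q with hκ
  have had : ∀ t, HasDerivAt a (δ * κ t) t := hasDerivAt_driftAction hβc
  have hXd : ∀ t, HasDerivAt X (2 * a t) t := hasDerivAt_driftAngle hβc
  have hκ1 : ∀ t, 0 ≤ κ t ∧ κ t ≤ 1 := fun t =>
    ⟨sq_nonneg _, pow_le_one₀ (hβpos _) (hβle _)⟩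
  have hκd : ∀ t, HasDerivAt κ (deriv κ t) t := fun t => by
    have hr := abs_sub_round_div_mul hq0 t
    exact (hasDerivAt_kickTrain hq1 hβ heven hβ0
      (hr.trans_lt (by linarith))).differentiableAt.hasDerivAt
  have hVpos : ∀ t, 0 < 1 - ρ * b (Θ t + 1 / 2) := fun t => by nlinarith [hb1 (Θ t + 1 / 2)]
  have hVd : ∀ t, HasDerivAt V (-(ρ * deriv b (Θ t + 1 / 2)) / (2 * N)) t := by
    intro t
    have h1 : HasDerivAt (fun t => b (Θ t + 1 / 2)) (deriv b (Θ t + 1 / 2) * (N⁻¹ * V t)) t :=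
      ((hb.differentiable (by simp) _).hasDerivAt).comp t ((hΘd t).add_const _)
    have h2 := ((h1.const_mul ρ).const_sub 1).sqrt (hVpos t).ne'
    refine h2.congr_deriv ?_
    have h3 : V t ≠ 0 := (Real.sqrt_pos.2 (hVpos t)).ne'
    change -(ρ * (deriv b (Θ t + 1 / 2) * (N⁻¹ * V t))) / (2 * V t) = _
    field_simp
  have hV1 : ∀ t, 0 ≤ V t ∧ V t ≤ 1 := fun t =>
    ⟨Real.sqrt_nonneg _, Real.sqrt_le_one.2 (by nlinarith [mul_nonneg hρ0 (hbpos (Θ t + 1 / 2))])⟩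
  set x : ℝ → Fin (e + 1 + 2) → ℝ := fun t =>
    assemble (X t) (fun i => t / (p : ℝ) ^ i) (Θ t) t with hx
  -- The middle actions are the frequencies divided by `A`; the last action is dictated by
  -- conservation of the total energy.
  set I : ℝ → Fin (e + 1 + 2) → ℝ := fun t =>
    assemble (a t) (fun i => 1 / (A * (p : ℝ) ^ i)) (V t / (A * N))
      (-(a t) ^ 2 + δ * (w (X t) * κ t)) with hI
  refine ⟨fun t => toTorus (x t), I, ⟨x, fun t ht => ⟨rfl, ?_, ?_⟩⟩, ?_⟩
  · -- the actions stay in the ball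
    have h0 : |a t| ≤ 1 / 2 := abs_driftAction_le hβc hq1 hqnat hδ0.le hδq ht
    have hlast : |-(a t) ^ 2 + δ * (w (X t) * κ t)| ≤ 1 / 4 + 1 / 16 := by
      refine (abs_add_le _ _).trans (add_le_add ?_ ?_)
      · rw [abs_neg, abs_pow]
        calc |a t| ^ 2 ≤ (1 / 2) ^ 2 := by gcongr
          _ = 1 / 4 := by norm_num
      · rw [abs_mul, abs_mul, abs_of_pos hδ0, abs_of_nonneg (hκ1 t).1]
        have := mul_le_one₀ (hwle (X t)) (hκ1 t).1 (hκ1 t).2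
        calc δ * (|w (X t)| * κ t) ≤ δ * 1 := by gcongr
          _ ≤ 1 / 16 := by linarith
    have hmid := norm1_assemble_le (e := e) (z := a t) (y := fun i => 1 / (A * (p : ℝ) ^ i))
      (v := V t / (A * N)) (u := -(a t) ^ 2 + δ * (w (X t) * κ t)) (c := 1 / A)
      (by
        rw [abs_of_nonneg (div_nonneg (hV1 t).1 (by positivity))]
        refine div_le_div₀ zero_le_one (hV1 t).2 hA0 ?_
        exact le_mul_of_one_le_right hA0.le (by linarith))
      (fun i => by
        rw [abs_of_nonneg (by positivity)]
        refine div_le_div_of_nonneg_left zero_le_one hA0 ?_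
        exact le_mul_of_one_le_right hA0.le (one_le_pow₀ (by linarith)))
    have h8 : ((e + 1 : ℕ) : ℝ) * (1 / A) ≤ 1 / 8 := by
      rw [mul_one_div, div_le_div_iff₀ hA0 (by norm_num)]; linarith
    exact hmid.trans_lt (by linarith)
  · -- Hamilton's equations
    have hx0 : x t 0 = X t := assemble_zero _ _ _ _
    have hxl : x t (lastIdx e) = t := assemble_last _ _ _ _
    have hxp : x t (pendIdx e) = Θ t := assemble_pend _ _ _ _
    have hI0 : I t 0 = a t := assemble_zero _ _ _ _
    have hIp : I t (pendIdx e) = V t / (A * N) := assemble_pend _ _ _ _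
    have hG := hasFDerivAt_potential_orbit (lam := lam) (δ := δ) (x := x t) (t := t) (by omega) hm hβ
      heven hβ0 hb hb1 hbtop hb0 hw hΘper hΘzero hΘlin hxl
      (fun j hj => assemble_mid _ _ _ _ hj) hxp
    have hslope : κ t * deriv w (X t) = κ t :=
      kickTrain_mul_deriv_ramp hβc heven hβ0 hwper hw0 hq1 hqnat hδ0.le hδq ht
    have hfd := fderiv_lift_unperturbed_add (A := A) (I := I t)
      (potential_add_int (e := e) (β := β) (p := p) (lam := lam) (δ := δ) hbper hwper) hG
    have hact := fun i => (hfd i).1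
    have hang : ∀ i, fderiv ℝ (lift (fun ϑ J => unperturbed A J +
        ofAngles (potential β b w p lam δ) ϑ J)) (x t, I t) (dirTheta i) =
        lam * (deriv b (Θ t + 1 / 2) * coordForm (pendIdx e) (Pi.single i 1)) -
          δ * (κ t * deriv w (x t 0) * coordForm 0 (Pi.single i 1) +
            w (x t 0) * deriv κ t * coordForm (lastIdx e) (Pi.single i 1)) := fun i =>
      (hfd i).2
    have hz1 : (0 : Fin (e + 1 + 2)) ≠ lastIdx e := zero_ne_lastIdx
    have hz2 : pendIdx e ≠ 0 := midIdx_ne_zero _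
    have hz3 : pendIdx e ≠ lastIdx e := midIdx_ne_last _
    refine forall_idx ?_ ?_ (fun j hj => ?_) ?_
    · rw [hact, hang, hessCoeff_zero, if_neg hz1, add_zero, coordForm_single_of_ne hz2,
        coordForm_single_self, coordForm_single_of_ne hz1.symm, hI0, hx0, mul_one, hslope]
      refine ⟨HasDerivAt.hasDerivWithinAt ?_, HasDerivAt.hasDerivWithinAt ?_⟩
      · simp only [hx, assemble_zero]
        exact hXd t
      · simp only [hI, assemble_zero]
        refine (had t).congr_deriv ?_
        ring
    · have hc : hessCoeff A (pendIdx e) = A := hessCoeff_mid A _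
      rw [hact, hang, hc, if_neg hz3, add_zero, coordForm_single_self,
        coordForm_single_of_ne hz2.symm, coordForm_single_of_ne hz3.symm, hIp]
      refine ⟨HasDerivAt.hasDerivWithinAt ?_, HasDerivAt.hasDerivWithinAt ?_⟩
      · simp only [hx, assemble_pend]
        refine (hΘd t).congr_deriv ?_
        simp only [hV]
        field_simp
      · simp only [hI, assemble_pend]
        refine ((hVd t).div_const (A * N)).congr_deriv ?_
        rw [hlam]
        field_simp
        ring
    · have h1 : pendIdx e ≠ midIdx j := fun h => hj (midIdx_injective h).symm
      have h2 : midIdx j ≠ lastIdx e := midIdx_ne_last _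
      rw [hact, hang, hessCoeff_mid, if_neg h2, add_zero, coordForm_single_of_ne h1,
        coordForm_single_of_ne (midIdx_ne_zero j).symm, coordForm_single_of_ne h2.symm]
      refine ⟨HasDerivAt.hasDerivWithinAt ?_, HasDerivAt.hasDerivWithinAt ?_⟩
      · simp only [hx, hI, assemble_mid _ _ _ _ hj]
        refine ((hasDerivAt_id' t).div_const ((p : ℝ) ^ (j.val + 1))).congr_deriv ?_
        field_simp
      · simp only [hI, assemble_mid _ _ _ _ hj]
        refine (hasDerivAt_const t (1 / (A * (p : ℝ) ^ (j.val + 1)))).congr_deriv ?_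
        ring
    · rw [hact, hang, hessCoeff_last, if_pos rfl, coordForm_single_self,
        coordForm_single_of_ne hz1, coordForm_single_of_ne hz3, hx0]
      refine ⟨HasDerivAt.hasDerivWithinAt ?_, HasDerivAt.hasDerivWithinAt ?_⟩
      · simp only [hx, assemble_last]
        refine (hasDerivAt_id' t).congr_deriv ?_
        ring
      · simp only [hI, assemble_last]
        have h1 : HasDerivAt (fun t => w (X t)) (deriv w (X t) * (2 * a t)) t :=
          ((hw.differentiable (by simp) _).hasDerivAt).comp t (hXd t)
        have h2 := ((had t).fun_pow 2).neg.add ((h1.mul (hκd t)).const_mul δ)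
        refine h2.congr_deriv ?_
        have h3 := hslope
        push_cast
        linear_combination (2 * δ * a t) * h3
  · -- the drift
    have h1 := Finset.single_le_sum (f := fun i => |(I (q ^ 2) - I 0) i|)
      (fun _ _ => abs_nonneg _) (Finset.mem_univ 0)
    refine le_trans (le_of_eq ?_) h1
    simp only [Pi.sub_apply, hI, assemble_zero, ha, driftAction, kickSum_zero,
      kickSum_sq hβc hq1 hqnat]
    rw [hδq]
    norm_num

end Orbit

/-! ### Sizes of the perturbations. -/

section Family

variable {e : ℕ} {M : ℕ → ℝ} {s : ℝ}

lemma derivBound_lift_ofAngles {W : ℕ → ℝ} {n : ℕ} {F : (Fin n → ℝ) → ℝ} {B σ : ℝ}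
    (hW : ∀ m, 0 ≤ W m) (hB : 0 ≤ B) (hσ : 0 ≤ σ)
    (hF : ∀ (x : Fin n → ℝ) (k : Fin n → ℤ), F (fun i => x i + k i) = F x)
    (h : DerivBound Set.univ W F B σ) (S : Set ((Fin n → ℝ) × (Fin n → ℝ))) :
    DerivBound S W (lift (ofAngles F)) B σ := by
  rw [lift_ofAngles hF]
  have := h.comp_linear (S := S) hW hB hσ
    (ContinuousLinearMap.fst ℝ (Fin n → ℝ) (Fin n → ℝ)) (ContinuousLinearMap.norm_fst_le _ _ _)
  rwa [one_mul] at this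

/-- For every `r > 0` small enough there is an unperturbed Hamiltonian all of whose perturbations of
size `(r / p)^{2 (n-2)}` can drift in time `(p^{n-2} m)²`, as soon as `m ≥ K p^{n-2} S(C p)`. -/
theorem exists_drifting_family (e : ℕ) (hM : IsWeight M) (h1 : CondH1 M) (h3 : CondH3 M)
    (hs : 0 < s) : ∃ C : ℝ, 0 < C ∧ ∀ r : ℝ, 0 < r → r ≤ 1 / (8 * (e + 1 : ℕ)) →
      ∃ A K : ℝ, 2 ≤ A ∧ ∀ p m : ℕ, 256 ≤ p → 1 ≤ m →
        K * (p : ℝ) ^ (e + 1) * weightSup M (C * p) ≤ m →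
        ∃ (f : Torus (e + 1 + 2) → (Fin (e + 1 + 2) → ℝ) → ℝ) (θ : ℝ → Torus (e + 1 + 2))
          (I : ℝ → Fin (e + 1 + 2) → ℝ),
          IsUltraDiff M s (fun ϑ J => unperturbed A J + f ϑ J) ∧ IsUltraDiff M s f ∧
          ultraNorm M s f ≤ ENNReal.ofReal ((r / p) ^ (2 * (e + 1))) ∧
          IsSolution (fun ϑ J => unperturbed A J + f ϑ J) (((p : ℝ) ^ (e + 1) * m) ^ 2) θ I ∧
          1 ≤ norm1 (I (((p : ℝ) ^ (e + 1) * m) ^ 2) - I 0) := by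
  have hM0 : ∀ m, 0 ≤ M m := fun m => (hM.1 m).le
  -- Chosen so that the final scale `6σ` satisfies `s (6σ) = 1/8`.
  set σ : ℝ := 1 / (48 * s) with hσdef
  have hσ : 0 < σ := by positivity
  have hsσ : s * (6 * σ) ≤ 1 / 8 := le_of_eq (by rw [hσdef]; field_simp; norm_num)
  obtain ⟨β, Bβ, hBβ, hβ, hβB, hβpos, hβle, heven, hβ1, hβ0⟩ := hM.exists_bump h3 hσ
  obtain ⟨b, Bb, hBb, hb, hbB, hbpos, hb1, hbper, hbtop, hb0⟩ := hM.exists_periodic_bump h3 hσ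
  obtain ⟨w, Bw, hBw, hw, hwB, hwle, hwper, hw0⟩ := hM.exists_periodic_ramp h3 hσ
  set C : ℝ := 8 * Real.pi * (e + 1 : ℕ) / σ with hC
  refine ⟨C, by positivity, fun r hr hr8 => ?_⟩
  set c₀ : ℝ := 4 * Real.pi ^ 2 / 3 with hc₀
  have hc₀1 : 1 ≤ c₀ := by
    have := Real.pi_gt_three
    rw [hc₀, le_div_iff₀ (by norm_num)]; nlinarith
  have hc₀0 : 0 < c₀ := by linarith
  have he1 : (1 : ℝ) ≤ (e + 1 : ℕ) := by exact_mod_cast Nat.succ_le_succ (Nat.zero_le e)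
  have hr1 : r ≤ 1 := hr8.trans (by rw [div_le_one (by positivity)]; linarith)
  set R : ℝ := r ^ (2 * (e + 1)) with hR
  have hR0 : 0 < R := by positivity
  have hRr : R ≤ r := pow_le_of_le_one hr.le hr1 (by omega)
  -- Since `ε = R / N²`, this makes the pendulum term, bounded by `1/(2AN²)` times `Bb`, use at most
  -- half of `ε`. It depends on `r` but not on `p`, so one `h` serves the whole family.
  set A : ℝ := c₀ * Bb / R with hA
  have hA8 : 8 * ((e + 1 : ℕ) : ℝ) ≤ A := by
    rw [hA, le_div_iff₀ hR0]
    calc 8 * ((e + 1 : ℕ) : ℝ) * R ≤ 8 * ((e + 1 : ℕ) : ℝ) * (1 / (8 * (e + 1 : ℕ))) := by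
          gcongr; exact hRr.trans hr8
      _ = 1 := by field_simp
      _ ≤ c₀ * Bb := by nlinarith
  set D : ℝ := Bw * (Bb * Bβ) ^ 2 with hD
  have hD0 : 0 < D := by positivity
  have hA0 : 0 < A := by linarith
  -- This `K` leaves the other half of `ε` to the kick, of strength `δ ≤ 16/(N m)`.
  refine ⟨A, 32 * c₀ * D / R, by linarith, fun p m hp hm hK => ?_⟩
  obtain ⟨lam, δ, hlam0, hlam, hδ0, hδ, θ, I, hsol, hdrift⟩ := exists_drifting_orbit hA8 hp hm hβ
    hβpos hβle heven hβ1 hβ0 hb hbpos hb1 hbper hbtop hb0 hw hwle hwper hw0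
  have hp0 : 0 < p := by omega
  have hp0' : (0 : ℝ) < p := by exact_mod_cast hp0
  have hm0 : (0 : ℝ) < m := by exact_mod_cast hm
  set Ssup := weightSup M (C * p) with hS
  have hS0 : 0 < Ssup := lt_of_lt_of_le one_pos (hM.one_le_weightSup h1 (by positivity))
  have hloc := derivBound_localPotential (e := e) (lam := lam) (δ := δ) hM h1 hσ hp0
    (zero_le_one.trans hBβ) (zero_le_one.trans hBb) (zero_le_one.trans hBw) hβ hβB hb hbB hw hwB
  rw [abs_of_nonneg hlam0, abs_of_nonneg hδ0] at hloc
  set B : ℝ := lam * Bb + δ * (Bw * ((Bb * Bβ) ^ 2 * Ssup)) with hB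
  have hB0 : 0 ≤ B := by positivity
  have hpot : DerivBound Set.univ M (potential (e := e) β b w p lam δ) B (6 * σ) :=
    hloc.of_local_translate fun x =>
      ⟨Pi.single (lastIdx e) (round (x (lastIdx e)) : ℝ), potential_eventuallyEq hβ0 x⟩
  have hper := potential_add_int (e := e) (β := β) (p := p) (lam := lam) (δ := δ) hbper hwper
  have hf := derivBound_lift_ofAngles hM0 hB0 (by positivity) hper hpot
    (Set.univ ×ˢ ballD (e + 1 + 2))
  refine ⟨ofAngles (potential β b w p lam δ), θ, I, ?_,
    isUltraDiff_of_derivBound hM hs hB0 (by positivity) hsσ hf, ?_, hsol, hdrift⟩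
  · obtain ⟨B', hB', hh⟩ := derivBound_unperturbed (e := e) hM h1 hσ A
    have hsum := (hh.mono hM0 (by positivity) hB' le_rfl (show 2 * σ ≤ 6 * σ by linarith)).add hf
    exact isUltraDiff_of_derivBound hM hs (add_nonneg hB' hB0) (by positivity) hsσ hsum
  · refine (ultraNorm_le hM hs hB0 (by positivity) hsσ hf).trans (ENNReal.ofReal_le_ofReal ?_)
    have hN0 : (0 : ℝ) < (p : ℝ) ^ (e + 1) := by positivity
    have e1 : (r / p) ^ (2 * (e + 1)) = R / ((p : ℝ) ^ (e + 1)) ^ 2 := by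
      rw [div_pow, hR, ← pow_mul, mul_comm (e + 1) 2]
    rw [e1]
    set N : ℝ := (p : ℝ) ^ (e + 1)
    have hone : c₀ * (lam * Bb) ≤ R / N ^ 2 / 2 := by
      calc c₀ * (lam * Bb) ≤ c₀ * (1 / (2 * A * N ^ 2) * Bb) := by gcongr
        _ = R / N ^ 2 / 2 := by rw [hA]; field_simp
    have htwo : c₀ * (δ * (Bw * ((Bb * Bβ) ^ 2 * Ssup))) ≤ R / N ^ 2 / 2 := by
      calc c₀ * (δ * (Bw * ((Bb * Bβ) ^ 2 * Ssup)))
          ≤ c₀ * (16 / (N * m) * (Bw * ((Bb * Bβ) ^ 2 * Ssup))) := by gcongr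
        _ = (32 * c₀ * D / R * N * Ssup) * (R / (2 * N ^ 2 * m)) := by
            rw [hD]; field_simp; ring
        _ ≤ m * (R / (2 * N ^ 2 * m)) := by gcongr
        _ = R / N ^ 2 / 2 := by field_simp
    calc c₀ * B = c₀ * (lam * Bb) + c₀ * (δ * (Bw * ((Bb * Bβ) ^ 2 * Ssup))) := by rw [hB]; ring
      _ ≤ R / N ^ 2 / 2 + R / N ^ 2 / 2 := add_le_add hone htwo
      _ = _ := by ring

end Family

end UltraDiffusion

/-! ### Choice of the parameters and estimate of the drift time. -/

theorem mainTheorem8 (n : ℕ) (hn : 3 ≤ n) (M : ℕ → ℝ) (hM : IsWeight M)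
    (hH1 : CondH1 M) (hH2 : CondH2 M) (hH3 : CondH3 M) (s : ℝ) (hs : 0 < s) :
    ∃ c₁ c₂ : ℝ, 0 < c₁ ∧ c₁ < c₂ ∧ c₂ < 1 ∧
    ∃ (h : (Fin n → ℝ) → ℝ) (l m : ℝ) (f : ℕ → Torus n → (Fin n → ℝ) → ℝ) (ε : ℕ → ℝ)
      (τ : ℕ → ℝ) (θ : ℕ → ℝ → Torus n) (I : ℕ → ℝ → Fin n → ℝ),
      0 < l ∧ 0 < m ∧ IsQuasiConvex l m h (ballD n) ∧
      (∀ j, 0 < ε j) ∧ Tendsto ε atTop (𝓝 0) ∧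
      (∀ j, IsUltraDiff M s (fun ϑ J => h J + f j ϑ J) ∧ IsUltraDiff M s (f j) ∧
        ultraNorm M s (f j) ≤ ENNReal.ofReal (ε j)) ∧
      (∀ j, 0 < τ j ∧ IsSolution (fun ϑ J => h J + f j ϑ J) (τ j) (θ j) (I j) ∧
        1 ≤ norm1 (I j (τ j) - I j 0)) ∧
      (∀ᶠ j in atTop,
        Real.exp (2 * Omega M (c₁ * ε j ^ (-(1 / (2 * ((n : ℝ) - 2)))))) ≤ τ j ∧
        τ j ≤ Real.exp (2 * Omega M (c₂ * ε j ^ (-(1 / (2 * ((n : ℝ) - 2))))))) := by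
  obtain ⟨e, rfl⟩ : ∃ e, n = e + 1 + 2 := ⟨n - 3, by omega⟩
  obtain ⟨C, hC, hfam⟩ := exists_drifting_family e hM hH1 hH3 hs
  -- The first bound gives `c₂ = 4Cr ≤ 1/2`; the second is the smallness required by
  -- `exists_drifting_family`.
  set r : ℝ := min (1 / (8 * C)) (1 / (8 * (e + 1 : ℕ))) with hrdef
  have hr : 0 < r := by positivity
  have hrC : C * r ≤ 1 / 8 := by
    calc C * r ≤ C * (1 / (8 * C)) := by gcongr; exact min_le_left _ _
      _ = 1 / 8 := by field_simp
  obtain ⟨A, K, hA, hAK⟩ := hfam r hr (min_le_right _ _)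
  have hCp : Tendsto (fun p : ℕ => C * (p : ℝ)) atTop atTop :=
    tendsto_natCast_atTop_atTop.const_mul_atTop hC
  have hCp2 : Tendsto (fun p : ℕ => 2 * C * (p : ℝ)) atTop atTop :=
    tendsto_natCast_atTop_atTop.const_mul_atTop (by positivity)
  -- At `y = Cp` the dilation makes `m ≥ S(2Cp)` admissible; at `y = 2Cp` it bounds `q ≤ 2 p^(e+1)
  -- S(2Cp)` by `S(4Cp)`.
  have hev := (hCp.eventually (hM.eventually_mul_weightSup_le hH1 hH2 (K / C ^ (e + 1)) (e + 1))).and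
    (hCp2.eventually (hM.eventually_mul_weightSup_le hH1 hH2 (2 / (2 * C) ^ (e + 1)) (e + 1)))
  obtain ⟨p₀, hp₀⟩ := eventually_atTop.1 (hev.and (eventually_ge_atTop 256))
  set P : ℕ → ℕ := fun j => p₀ + j with hP
  have hPp : ∀ j, p₀ ≤ P j := fun j => Nat.le_add_right _ _
  have hP256 : ∀ j, 256 ≤ P j := fun j => (hp₀ _ (hPp j)).2
  have hPpos : ∀ j, (0 : ℝ) < P j := fun j => by
    have := hP256 j
    exact_mod_cast (by omega : 0 < P j)
  set S : ℕ → ℝ := fun j => weightSup M (2 * C * P j) with hS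
  have hS1 : ∀ j, 1 ≤ S j := fun j => hM.one_le_weightSup hH1 (by have := hPpos j; positivity)
  set m : ℕ → ℕ := fun j => ⌈S j⌉₊ with hm
  have hSm : ∀ j, S j ≤ m j := fun j => Nat.le_ceil _
  have hmS : ∀ j, (m j : ℝ) ≤ 2 * S j := fun j => by
    have := Nat.ceil_lt_add_one (zero_le_one.trans (hS1 j))
    linarith [hS1 j]
  have hm1 : ∀ j, 1 ≤ m j := fun j => by
    have := (hS1 j).trans (hSm j)
    exact_mod_cast this
  have hK : ∀ j, K * (P j : ℝ) ^ (e + 1) * weightSup M (C * P j) ≤ m j := fun j => by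
    refine le_trans ?_ (hSm j)
    have := (hp₀ _ (hPp j)).1.1
    rw [← mul_assoc, mul_pow] at this
    refine le_trans (le_of_eq ?_) this
    field_simp
  choose f θ I hH hf hfn hsol hdrift using fun j => hAK (P j) (m j) (hP256 j) (hm1 j) (hK j)
  have hN1 : ∀ j, (1 : ℝ) ≤ (P j : ℝ) ^ (e + 1) := fun j =>
    one_le_pow₀ (by exact_mod_cast (show 1 ≤ P j by have := hP256 j; omega))
  -- The power of `ε` in the statement is exactly `p / r`, so `c₁ = 2Cr` and `c₂ = 4Cr` put `S` at
  -- `2Cp` and `4Cp`.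
  have hroot : ∀ j, ((r / P j) ^ (2 * (e + 1))) ^ (-(1 / (2 * (((e + 1 + 2 : ℕ) : ℝ) - 2)))) =
      P j / r := fun j => by
    have hx : 0 ≤ r / P j := (div_pos hr (hPpos j)).le
    rw [show -(1 / (2 * (((e + 1 + 2 : ℕ) : ℝ) - 2))) = -(((2 * (e + 1) : ℕ) : ℝ)⁻¹) by
      push_cast; rw [one_div]; ring_nf]
    rw [Real.rpow_neg (by positivity), Real.pow_rpow_inv_natCast hx (by omega), inv_div]
  refine ⟨2 * C * r, 4 * C * r, by positivity, by nlinarith [mul_pos hC hr], by linarith,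
    unperturbed A, 1 / 2, 2 / ((e + 1 + 2 : ℕ) * (2 * (A + 1)) ^ 2), f,
    fun j => (r / P j) ^ (2 * (e + 1)), fun j => ((P j : ℝ) ^ (e + 1) * m j) ^ 2, θ, I,
    by norm_num, by positivity, isQuasiConvex_unperturbed hA, fun j => ?_, ?_,
    fun j => ⟨hH j, hf j, hfn j⟩, fun j => ⟨?_, hsol j, hdrift j⟩, Eventually.of_forall fun j => ?_⟩
  · have := hPpos j; positivity
  · have hPt : Tendsto (fun j => (P j : ℝ)) atTop atTop :=
      tendsto_natCast_atTop_atTop.comp (tendsto_atTop_mono (fun j => Nat.le_add_left j p₀) tendsto_id)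
    have := (hPt.const_div_atTop r).pow (2 * (e + 1))
    rwa [zero_pow (by omega)] at this
  · have h1 := hPpos j
    have h2 : (0 : ℝ) < m j := by exact_mod_cast hm1 j
    positivity
  · simp only [hroot]
    have h1 := hPpos j
    have hS0 := zero_le_one.trans (hS1 j)
    rw [show 2 * C * r * (P j / r) = 2 * C * P j by field_simp,
      show 4 * C * r * (P j / r) = 2 * (2 * C * P j) by field_simp; ring,
      hM.exp_two_Omega hH1 (by positivity), hM.exp_two_Omega hH1 (by positivity)]
    constructor
    · gcongr
      calc S j ≤ 1 * m j := by rw [one_mul]; exact hSm j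
        _ ≤ (P j : ℝ) ^ (e + 1) * m j := by gcongr; exact hN1 j
    · gcongr
      have := (hp₀ _ (hPp j)).1.2
      refine le_trans ?_ this
      calc (P j : ℝ) ^ (e + 1) * m j ≤ (P j : ℝ) ^ (e + 1) * (2 * S j) := by gcongr; exact hmS j
        _ = _ := by rw [mul_pow (2 * C)]; simp only [hS]; field_simp
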